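/- **Setting.** Let $H, U_1, U_2, W$ be real Hilbert spaces, $A:\mathcal D(A)\to H$ a positive self-adjoint operator with compact inverse, and $V=\mathcal D(A^{1/2})$ with $\|u\|_V=\|A^{1/2}u\|_H$; $H$ is identified with a subspace of $V'$. Let $\tau>0$, let $0=t_0<t_1<t_2<\dots$, and let $I_n=[t_n,t_{n+1})$. Assume that the even intervals have constant length $t_{2n+1}-t_{2n}=T^*\ge\tau$ and the odd intervals have constant length $t_{2n+2}-t_{2n+1}=\tilde T\le\tau$, for all $n\in\mathbb N=\{0,1,2,\dots\}$. Let $B_1(t)\in\mathcal L(U_1,V')$, with adjoint $B_1^*(t)\in\mathcal L(V,U_1)$, and $B_2(t)\in\mathcal L(U_2,H)$ be such that, for every $n$, $B_2=0$ on $I_{2n}$, $B_1=0$ on $I_{2n+1}$, the restriction of $B_2$ to $I_{2n+1}$ extends to an element of $C([t_{2n+1},t_{2n+2}];\mathcal L(U_2,H))$, and on $I_{2n}$ either $B_1$ extends to an element of $C^1([t_{2n},t_{2n+1}];\mathcal L(U_1,H))$, or $B_1(t)=\sqrt{b_1(t)}\,C_n$ with $C_n\in\mathcal L(U_1,V')$,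 $b_1\in W^{2,\infty}(t_{2n},t_{2n+1})$ and $b_1>0$ on $I_{2n}$. Assume that $H$ embeds into $W$ and $V$ embeds into $U_1$ through continuous linear maps (suppressed in the notation; they need not be injective), with $\|u\|_W^2\le C\|u\|_H^2$ for all $u\in H$, $C>0$, and that there are positive constants $m_{2n}\le M_{2n}$ and $M_{2n+1}$ such that for all $n$ * i) $m_{2n}\|u\|_{U_1}^2\le\|B_1^*(t)u\|_{U_1}^2\le M_{2n}\|u\|_{U_1}^2$ for all $t\in I_{2n}$, $u\in V$; * ii) $\|B_2^*(t)u\|_{U_2}^2\le M_{2n+1}\|u\|_W^2$ for all $t\in I_{2n+1}$, $u\in H$. Write $E_S(t)=E_S(u,t)=\frac12\big(\|u(t)\|_V^2+\|u_t(t)\|_H^2\big)$. Consider the delayed problem $$u_{tt}(t)+Au(t)+B_1(t)B_1^*(t)u_t(t)+B_2(t)B_2^*(t)u_t(t-\tau)=0,\quad t>0,\qquad u(0)=u_0\in V,\ u_t(0)=u_1\in H,\tag{P}$$ and, for each $n$, the damped problem without delay $$w_{tt}+Aw+B_1(t)B_1^*(t)w_t=0\ \text{ on }(t_{2n},t_{2n+1}),\qquad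 w(t_{2n})=w_0^n\in V,\ w_t(t_{2n})=w_1^n\in H.\tag{D$_n$}$$ Solutions are weak solutions: functions in $C([0,\infty);V)\cap C^1([0,\infty);H)$ (respectively on $[t_{2n},t_{2n+1}]$) for which, on each $(t_{2n},t_{2n+1})$, the output $B_1^*u_t$ exists in $L^2(t_{2n},t_{2n+1};U_1)$ as the strong $L^2$ limit of $t\mapsto B_1^*(t)\frac{u(t+h)-u(t)}h$ as $h\to0^+$ (on $(t_{2n},t_{2n+1}-h)$), and which satisfy the equation in $V'$, integrated in time. (As $B_2=0$ on $[0,\tau)$, no values of $u_t$ at negative times are needed.) **Observability.** Assume that for every $n$ there is a time $\overline T_n\in[0,T^*)$ such that for every $T\in(\overline T_n,T^*]$ there is a constant $d_n=d_n(T)\ge0$, independent of the initial data, with $$E_S(w,t_{2n}+T)\le d_n(T)\int_{t_{2n}}^{t_{2n}+T}\|B_1^*(t)w_t(t)\|_{U_1}^2\,dt$$ for every weak solution $w$ of (D$_n$). Put $\hat d_n=\dfrac{d_n(T^*)}{d_n(T^*)+1}$. **Theorem.** If $$\sup_{n\in\mathbb N}\Big[e^{CM_{2n+1}\tilde T}(\hat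 d_n+1)-1\Big]<1,$$ then there exist constants $\hat\gamma,\hat\mu>0$ such that $$E_S(u,t)\le\hat\gamma e^{-\hat\mu t}E_S(u,0),\qquad t>0,$$ for every solution $u$ of (P) (for all initial data $(u_0,u_1)\in V\times H$). -/

import Mathlib

open MeasureTheory Set Filter Topology
open scoped InnerProductSpace RealInnerProductSpace NNReal LinearPMap

noncomputable section

namespace DelayDamping

/-! ### The operator `A`, its square root and the space `V = D(A^{1/2})` -/

section Operator

variable {H : Type*} [NormedAddCommGroup H] [InnerProductSpace ℝ H] [CompleteSpace H]

/-- A (densely defined) positive self-adjoint operator `A : D(A) → H` with a compact inverse. -/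
structure PosOp (H : Type*) [NormedAddCommGroup H] [InnerProductSpace ℝ H]
    [CompleteSpace H] where
  op : H →ₗ.[ℝ] H
  selfAdjoint : IsSelfAdjoint op
  positive : ∀ x : op.domain, x ≠ 0 → 0 < ⟪op x, (x : H)⟫
  compactInverse : ∃ G : H →L[ℝ] H, IsCompactOperator G ∧
    (∀ y : H, ∃ h : G y ∈ op.domain, op ⟨G y, h⟩ = y) ∧ (∀ x : op.domain, G (op x) = x)

/-- `R` is a positive self-adjoint square root of `A`: `R ∘ R = A`, domains included. -/
def IsSqrt (R A : H →ₗ.[ℝ] H) : Prop :=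
  IsSelfAdjoint R ∧ (∀ x : R.domain, 0 ≤ ⟪R x, (x : H)⟫) ∧
    ∀ x y : H, (x, y) ∈ A.graph ↔ ∃ z : H, (x, z) ∈ R.graph ∧ (z, y) ∈ R.graph

/-- A compact positive symmetric operator has a positive symmetric square root. -/
theorem exists_bounded_sqrt (G : H →L[ℝ] H) (hc : IsCompactOperator G)
    (hs : ∀ x y : H, ⟪G x, y⟫ = ⟪x, G y⟫) (hp : ∀ x : H, 0 ≤ ⟪G x, x⟫) :
    ∃ S : H →L[ℝ] H, (∀ x y : H, ⟪S x, y⟫ = ⟪x, S y⟫) ∧ (∀ x : H, 0 ≤ ⟪S x, x⟫) ∧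
      ∀ x : H, S (S x) = G x := by
  classical
  have hsym : (G : H →ₗ[ℝ] H).IsSymmetric := fun x y => hs x y
  let E : ℝ → Submodule ℝ H := fun μ => Module.End.eigenspace (G : H →ₗ[ℝ] H) μ
  have hE : ∀ μ (x : E μ), G x = μ • (x : H) := fun μ x => Module.End.mem_eigenspace_iff.1 x.2
  have hcl : ∀ μ, IsClosed (E μ : Set H) := by
    intro μ
    have : (E μ : Set H) = {x | G x = μ • x} := by
      ext x; exact Module.End.mem_eigenspace_iff
    rw [this]
    exact isClosed_eq G.continuous (continuous_const_smul μ)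
  have : ∀ μ, CompleteSpace (E μ) := fun μ => (hcl μ).completeSpace_coe
  have hort := hsym.orthogonalFamily_eigenspaces
  have htot : (⨆ μ, E μ)ᗮ = ⊥ :=
    ContinuousLinearMap.orthogonalComplement_iSup_eigenspaces_eq_bot hc hsym
  have hsum : IsHilbertSum ℝ (fun μ => E μ) (fun μ => (E μ).subtypeₗᵢ) := by
    refine IsHilbertSum.mkInternal _ hort ?_
    rw [← Submodule.orthogonal_orthogonal_eq_closure, htot, Submodule.bot_orthogonal_eq_top]
  let e := hsum.linearIsometryEquiv
  have hbound : ∀ μ (x : E μ), ‖√μ • x‖ ≤ √‖G‖ * ‖x‖ := by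
    intro μ x
    rw [norm_smul, Real.norm_of_nonneg (Real.sqrt_nonneg _)]
    rcases eq_or_ne x 0 with rfl | hx
    · simp
    · gcongr
      have h1 : 0 < ‖(x : H)‖ := by simpa using hx
      have h2 : ‖μ • (x : H)‖ ≤ ‖G‖ * ‖(x : H)‖ := by
        rw [← hE]; exact G.le_opNorm _
      rw [norm_smul] at h2
      exact (le_abs_self μ).trans (le_of_mul_le_mul_right h2 h1)
  have hnn : ∀ μ (x : E μ), x ≠ 0 → 0 ≤ μ := by
    intro μ x hx
    have h1 := hp x
    rw [hE, real_inner_smul_left, real_inner_self_eq_norm_sq] at h1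
    have h2 : 0 < ‖(x : H)‖ ^ 2 := by
      have : 0 < ‖(x : H)‖ := by simpa using hx
      positivity
    exact nonneg_of_mul_nonneg_left h1 h2
  have hmem : ∀ f : lp (fun μ => E μ) 2, Memℓp (fun μ => √μ • f μ) 2 := by
    intro f
    refine memℓp_gen ?_
    have h1 := (lp.memℓp f).summable (by norm_num)
    refine Summable.of_nonneg_of_le (fun μ => by positivity) (fun μ => ?_)
      (h1.mul_left ((√‖G‖) ^ (2 : ENNReal).toReal))
    rw [← Real.mul_rpow (by positivity) (by positivity)]
    exact Real.rpow_le_rpow (by positivity) (hbound μ _) (by norm_num)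
  let D0 : lp (fun μ => E μ) 2 →ₗ[ℝ] lp (fun μ => E μ) 2 :=
    { toFun := fun f => ⟨fun μ => √μ • f μ, hmem f⟩
      map_add' := fun f g => by
        ext μ
        exact congrArg Subtype.val (smul_add (√μ) (f μ) (g μ))
      map_smul' := fun c f => by
        ext μ
        simp only [lp.coeFn_smul, Pi.smul_apply, RingHom.id_apply]
        rw [smul_comm] }
  have hD0 : ∀ f μ, (D0 f) μ = √μ • f μ := fun f μ => rfl
  let D : lp (fun μ => E μ) 2 →L[ℝ] lp (fun μ => E μ) 2 := D0.mkContinuous (√‖G‖) (by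
    intro f
    have hp2 : 0 < (2 : ENNReal).toReal := by norm_num
    refine lp.norm_le_of_forall_sum_le hp2 (by positivity) (fun s => ?_)
    rw [Real.mul_rpow (by positivity) (by positivity)]
    calc ∑ μ ∈ s, ‖D0 f μ‖ ^ (2 : ENNReal).toReal
        ≤ ∑ μ ∈ s, (√‖G‖) ^ (2 : ENNReal).toReal * ‖f μ‖ ^ (2 : ENNReal).toReal := by
          refine Finset.sum_le_sum fun μ _ => ?_
          rw [← Real.mul_rpow (by positivity) (by positivity)]
          exact Real.rpow_le_rpow (by positivity) (hbound μ _) (by norm_num)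
      _ = (√‖G‖) ^ (2 : ENNReal).toReal * ∑ μ ∈ s, ‖f μ‖ ^ (2 : ENNReal).toReal := by
          rw [Finset.mul_sum]
      _ ≤ _ := by
          gcongr
          exact lp.sum_rpow_le_norm_rpow hp2 f s)
  have hD : ∀ f μ, (D f) μ = √μ • f μ := fun f μ => rfl
  have hDG : ∀ f, e.symm (D (D f)) = G (e.symm f) := by
    intro f
    have h1 := (hsum.hasSum_linearIsometryEquiv_symm f).mapL G
    have h2 := hsum.hasSum_linearIsometryEquiv_symm (D (D f))
    refine h2.unique ?_
    convert h1 using 2 with μ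
    change ((D (D f) μ : E μ) : H) = G (f μ : H)
    rw [hE, hD, hD]
    rcases eq_or_ne (f μ) 0 with h0 | h0
    · simp [h0]
    · rw [smul_smul, Real.mul_self_sqrt (hnn μ _ h0)]
      rfl
  refine ⟨(e.symm.toContinuousLinearEquiv : _ →L[ℝ] H) ∘L D ∘L
    (e.toContinuousLinearEquiv : H →L[ℝ] _), ?_, ?_, ?_⟩
  · intro x y
    have h1 : ∀ a b, ⟪D a, b⟫ = ⟪a, D b⟫ := by
      intro a b
      rw [lp.inner_eq_tsum, lp.inner_eq_tsum]
      congr 1; ext μ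
      rw [hD, hD, real_inner_smul_left, real_inner_smul_right]
    have h2 := h1 (e x) (e y)
    rw [← e.symm.inner_map_map, ← e.symm.inner_map_map (e x)] at h2
    simpa using h2
  · intro x
    have h1 : 0 ≤ ⟪D (e x), e x⟫ := by
      rw [lp.inner_eq_tsum]
      refine tsum_nonneg fun μ => ?_
      rw [hD, real_inner_smul_left]
      exact mul_nonneg (Real.sqrt_nonneg _) real_inner_self_nonneg
    rw [← e.symm.inner_map_map] at h1
    simpa using h1
  · intro x
    have := hDG (e x)
    simpa using this

/-- Every positive self-adjoint operator with a compact inverse has a square root. -/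
theorem PosOp.exists_sqrt (A : PosOp H) : ∃ R : H →ₗ.[ℝ] H, IsSqrt R A.op := by
  obtain ⟨G, hGc, hG1, hG2⟩ := A.compactInverse
  have hAs : ∀ x y : A.op.domain, ⟪A.op x, (y : H)⟫ = ⟪(x : H), A.op y⟫ := by
    intro x y
    have h := LinearPMap.adjoint_isFormalAdjoint (T := A.op) A.selfAdjoint.dense_domain
    rw [LinearPMap.isSelfAdjoint_def.1 A.selfAdjoint] at h
    exact h x y
  have hpos : ∀ x : A.op.domain, 0 ≤ ⟪A.op x, (x : H)⟫ := by
    intro x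
    rcases eq_or_ne x 0 with rfl | hx
    · simp
    · exact (A.positive x hx).le
  obtain ⟨S, hS1, hS2, hS3⟩ := exists_bounded_sqrt G hGc
    (by
      intro x y
      obtain ⟨hx, hx'⟩ := hG1 x
      obtain ⟨hy, hy'⟩ := hG1 y
      have := hAs ⟨G x, hx⟩ ⟨G y, hy⟩
      rw [hx', hy'] at this
      exact this.symm)
    (by
      intro x
      obtain ⟨hx, hx'⟩ := hG1 x
      have := hpos ⟨G x, hx⟩
      rw [hx', real_inner_comm] at this
      exact this)
  have hGi : ∀ x, G x = 0 → x = 0 := by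
    intro x hx
    obtain ⟨h, h'⟩ := hG1 x
    have h0 : (⟨G x, h⟩ : A.op.domain) = 0 := Subtype.ext hx
    rw [← h', h0]
    exact A.op.toFun.map_zero
  have hSi : ∀ x, S x = 0 → x = 0 := fun x hx => hGi x (by rw [← hS3, hx, map_zero])
  have hSinj : Function.Injective S := (injective_iff_map_eq_zero S).2 hSi
  let eS : H ≃ₗ[ℝ] LinearMap.range (S : H →ₗ[ℝ] H) := LinearEquiv.ofInjective (S : H →ₗ[ℝ] H) hSinj
  let R : H →ₗ.[ℝ] H := ⟨LinearMap.range (S : H →ₗ[ℝ] H), eS.symm.toLinearMap⟩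
  have hRg : ∀ x y, (x, y) ∈ R.graph ↔ S y = x := by
    intro x y
    rw [LinearPMap.mem_graph_iff]
    constructor
    · rintro ⟨z, rfl, rfl⟩
      have : eS (eS.symm z) = z := eS.apply_symm_apply z
      exact congrArg Subtype.val this
    · rintro rfl
      exact ⟨eS y, rfl, eS.symm_apply_apply y⟩
  have hRS : ∀ y : H, R (eS y) = y := fun y => eS.symm_apply_apply y
  have hSR : ∀ x : R.domain, S (R x) = x := fun x => (hRg _ _).1 (R.mem_graph x)
  have hdense : Dense (R.domain : Set H) := by
    have : R.domainᗮ = ⊥ := by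
      rw [eq_bot_iff]
      intro y hy
      refine hSi y ?_
      have h := (Submodule.mem_orthogonal _ _).1 hy (S (S y)) ⟨S y, rfl⟩
      rw [hS1] at h
      exact inner_self_eq_zero.1 h
    exact (Submodule.dense_iff_topologicalClosure_eq_top).2
      ((Submodule.topologicalClosure_eq_top_iff).2 this)
  refine ⟨R, ?_, ?_, ?_⟩
  · rw [LinearPMap.isSelfAdjoint_def]
    have hadj : ∀ x : R†.domain, S (R† x) = x := by
      intro x
      refine ext_inner_right ℝ fun h => ?_
      have := LinearPMap.adjoint_isFormalAdjoint hdense x (eS h)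
      rw [hRS] at this
      exact (hS1 _ _).trans this
    refine le_antisymm ?_ ?_
    · refine ⟨fun y hy => ⟨R† ⟨y, hy⟩, hadj ⟨y, hy⟩⟩, fun x y hxy => ?_⟩
      exact hSinj (by rw [hadj, hSR, hxy])
    · refine LinearPMap.IsFormalAdjoint.le_adjoint hdense ?_
      intro x y
      calc ⟪R x, (y : H)⟫ = ⟪R x, S (R y)⟫ := by rw [hSR]
        _ = ⟪S (R x), R y⟫ := (hS1 _ _).symm
        _ = ⟪(x : H), R y⟫ := by rw [hSR]
  · intro x
    have := hS2 (R x)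
    rwa [hSR, real_inner_comm] at this
  · intro x y
    simp only [hRg]
    rw [LinearPMap.mem_graph_iff]
    constructor
    · rintro ⟨z, rfl, rfl⟩
      exact ⟨S (A.op z), by rw [hS3, hG2], rfl⟩
    · rintro ⟨z, rfl, rfl⟩
      rw [hS3]
      obtain ⟨h, h'⟩ := hG1 y
      exact ⟨⟨G y, h⟩, rfl, h'⟩

/-- The operator `A^{1/2}`. (The positive self-adjoint square root is unique.) -/
def PosOp.sqrt (A : PosOp H) : H →ₗ.[ℝ] H := A.exists_sqrt.choose

theorem PosOp.sqrt_spec (A : PosOp H) : IsSqrt A.sqrt A.op := A.exists_sqrt.choose_spec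

/-- The space `V = D(A^{1/2})`, with the inner product `⟪u, v⟫_V = ⟪A^{1/2} u, A^{1/2} v⟫_H`. -/
def PosOp.V (A : PosOp H) : Type _ := A.sqrt.domain

instance (A : PosOp H) : AddCommGroup A.V := inferInstanceAs (AddCommGroup A.sqrt.domain)

instance (A : PosOp H) : Module ℝ A.V := inferInstanceAs (Module ℝ A.sqrt.domain)

/-- The inclusion `V ⊆ H`, as a linear map. -/
def PosOp.inclLin (A : PosOp H) : A.V →ₗ[ℝ] H := A.sqrt.domain.subtype

/-- `A^{1/2}` as a linear map `V → H`. -/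
def PosOp.sqrtV (A : PosOp H) : A.V →ₗ[ℝ] H := A.sqrt.toFun

theorem PosOp.norm_incl_le (A : PosOp H) :
    ∃ c : ℝ, ∀ u : A.V, ‖A.inclLin u‖ ≤ c * ‖A.sqrtV u‖ := by
  obtain ⟨G, -, hG1, -⟩ := A.compactInverse
  obtain ⟨hR1, -, hR3⟩ := A.sqrt_spec
  have hsym : ∀ x y : A.V, ⟪A.sqrtV x, A.inclLin y⟫ = ⟪A.inclLin x, A.sqrtV y⟫ := by
    intro x y
    have h := LinearPMap.adjoint_isFormalAdjoint (T := A.sqrt) hR1.dense_domain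
    rw [LinearPMap.isSelfAdjoint_def.1 hR1] at h
    exact h x y
  refine ⟨√‖G‖, fun u => ?_⟩
  obtain ⟨hx, hx'⟩ := hG1 (A.inclLin u)
  have h1 : (G (A.inclLin u), A.inclLin u) ∈ A.op.graph :=
    (LinearPMap.mem_graph_iff _).2 ⟨⟨_, hx⟩, rfl, hx'⟩
  obtain ⟨z, hz1, hz2⟩ := (hR3 _ _).1 h1
  obtain ⟨p, hp1, hp2⟩ := (LinearPMap.mem_graph_iff _).1 hz1
  obtain ⟨q, hq1, hq2⟩ := (LinearPMap.mem_graph_iff _).1 hz2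
  let p' : A.V := p
  let q' : A.V := q
  have hp1 : A.inclLin p' = G (A.inclLin u) := hp1
  have hp2 : A.sqrtV p' = z := hp2
  have hq1 : A.inclLin q' = z := hq1
  have hq2 : A.sqrtV q' = A.inclLin u := hq2
  have e1 : ‖A.inclLin u‖ ^ 2 = ⟪A.sqrtV u, z⟫ := by
    rw [← real_inner_self_eq_norm_sq]
    nth_rewrite 2 [← hq2]
    rw [← hsym, hq1]
  have e2 : ‖z‖ ^ 2 = ⟪A.inclLin u, G (A.inclLin u)⟫ := by
    rw [← real_inner_self_eq_norm_sq, ← hp1, ← hq2, hsym, hq1, hp2]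
  have e3 : ‖z‖ ≤ √‖G‖ * ‖A.inclLin u‖ := by
    refine (sq_le_sq₀ (norm_nonneg _) (by positivity)).1 ?_
    rw [e2, mul_pow, Real.sq_sqrt (norm_nonneg _)]
    calc ⟪A.inclLin u, G (A.inclLin u)⟫ ≤ ‖A.inclLin u‖ * ‖G (A.inclLin u)‖ :=
          real_inner_le_norm _ _
      _ ≤ ‖A.inclLin u‖ * (‖G‖ * ‖A.inclLin u‖) := by gcongr; exact G.le_opNorm _
      _ = _ := by ring
  rcases eq_or_lt_of_le (norm_nonneg (A.inclLin u)) with h0 | h0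
  · rw [← h0]; positivity
  · have h4 : ‖A.inclLin u‖ * ‖A.inclLin u‖ ≤ √‖G‖ * ‖A.sqrtV u‖ * ‖A.inclLin u‖ := by
      calc ‖A.inclLin u‖ * ‖A.inclLin u‖ = ⟪A.sqrtV u, z⟫ := by rw [← e1]; ring
        _ ≤ ‖A.sqrtV u‖ * ‖z‖ := real_inner_le_norm _ _
        _ ≤ ‖A.sqrtV u‖ * (√‖G‖ * ‖A.inclLin u‖) := by gcongr
        _ = _ := by ring
    exact le_of_mul_le_mul_right h4 h0

/-- The inner product of `V`. -/
@[reducible] def PosOp.core (A : PosOp H) : InnerProductSpace.Core ℝ A.V where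
  inner u v := ⟪A.sqrtV u, A.sqrtV v⟫
  conj_inner_symm u v := real_inner_comm _ _
  re_inner_nonneg u := real_inner_self_nonneg
  add_left u v w := by simp only [map_add, inner_add_left]
  smul_left u v c := by simp only [map_smul, real_inner_smul_left]; rfl
  definite u hu := by
    obtain ⟨c, hc⟩ := A.norm_incl_le
    have h1 := hc u
    rw [inner_self_eq_zero.1 hu, norm_zero, mul_zero] at h1
    exact Subtype.ext (norm_le_zero_iff.1 h1)

instance (A : PosOp H) : NormedAddCommGroup A.V := A.core.toNormedAddCommGroup

instance (A : PosOp H) : InnerProductSpace ℝ A.V := InnerProductSpace.ofCore A.core.toCore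

theorem PosOp.inner_V (A : PosOp H) (u v : A.V) : ⟪u, v⟫ = ⟪A.sqrtV u, A.sqrtV v⟫ := rfl

theorem PosOp.norm_V (A : PosOp H) (u : A.V) : ‖u‖ = ‖A.sqrtV u‖ := by
  rw [norm_eq_sqrt_real_inner, PosOp.inner_V, norm_eq_sqrt_real_inner]

/-- The continuous inclusion `V → H`. -/
def PosOp.incl (A : PosOp H) : A.V →L[ℝ] H :=
  A.inclLin.mkContinuousOfExistsBound (by
    obtain ⟨c, hc⟩ := A.norm_incl_le
    exact ⟨c, fun u => by rw [A.norm_V]; exact hc u⟩)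

/-- The inclusion `H → V'` (`H` being the pivot space): `h ↦ ⟪h, ·⟫_H`. -/
def PosOp.pivot (A : PosOp H) : H →L[ℝ] StrongDual ℝ A.V :=
  ((ContinuousLinearMap.compL ℝ A.V H ℝ).flip A.incl) ∘L innerSL ℝ

theorem PosOp.pivot_apply (A : PosOp H) (h : H) (v : A.V) : A.pivot h v = ⟪h, A.incl v⟫ := rfl

/-- The standard energy `E_S = (‖u‖_V² + ‖u_t‖_H²) / 2` of the state `(u, u_t)`. -/
def PosOp.energy (A : PosOp H) (u : A.V) (v : H) : ℝ := (‖u‖ ^ 2 + ‖v‖ ^ 2) / 2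

end Operator

/-! ### The damping operators -/

section Damping

variable {H : Type*} [NormedAddCommGroup H] [InnerProductSpace ℝ H] [CompleteSpace H]
  {U₁ : Type*} [NormedAddCommGroup U₁] [InnerProductSpace ℝ U₁] [CompleteSpace U₁]
  {U₂ : Type*} [NormedAddCommGroup U₂] [InnerProductSpace ℝ U₂] [CompleteSpace U₂]

/-- The adjoint `B* : V → U₁` of `B : U₁ → V'`: `⟪B* v, x⟫_{U₁} = ⟨B x, v⟩_{V', V}`. -/
def dualOp {A : PosOp H} (B : U₁ →L[ℝ] StrongDual ℝ A.V) : A.V →L[ℝ] U₁ :=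
  LinearMap.mkContinuous
    { toFun := fun v => (InnerProductSpace.toDual ℝ U₁).symm (B.flip v)
      map_add' := fun v w => by simp only [map_add]
      map_smul' := fun c v => by
        rw [map_smul, LinearIsometryEquiv.map_smulₛₗ]
        rfl }
    ‖B.flip‖ (fun v => by
      simpa using B.flip.le_opNorm v)

theorem dualOp_inner {A : PosOp H} (B : U₁ →L[ℝ] StrongDual ℝ A.V) (v : A.V) (x : U₁) :
    ⟪dualOp B v, x⟫ = B x v :=
  InnerProductSpace.toDual_symm_apply (𝕜 := ℝ)

/-- `β ∈ W^{2,∞}(a, b)`, for the continuous representative of `β` on `[a, b]`: `β` has a Lipschitz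
derivative. -/
def IsW2Infty (β : ℝ → ℝ) (a b : ℝ) : Prop :=
  ∃ (β' : ℝ → ℝ) (K : ℝ≥0), (∀ s ∈ Icc a b, HasDerivWithinAt β (β' s) (Icc a b) s) ∧
    LipschitzOnWith K β' (Icc a b)

/-- Time regularity of the undelayed damping operator on `[a, b)`: either it is bounded and
`B₁ ∈ C¹([a, b]; L(U₁, H))`, or `B₁(s) = √(β(s)) C` with `C ∈ L(U₁, V')`,
`β ∈ W^{2,∞}(a, b)`, `β > 0` on `[a, b)`. The value at `s = b` plays no role (there the
operator `B₁(b)` is `0`). -/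
def RegularB₁ (A : PosOp H) (B₁ : ℝ → U₁ →L[ℝ] StrongDual ℝ A.V) (a b : ℝ) : Prop :=
  (∃ F : ℝ → U₁ →L[ℝ] H, ContDiffOn ℝ 1 F (Icc a b) ∧ ∀ s ∈ Ico a b, B₁ s = A.pivot ∘L F s) ∨
  (∃ (β : ℝ → ℝ) (C : U₁ →L[ℝ] StrongDual ℝ A.V), IsW2Infty β a b ∧
    (∀ s ∈ Ico a b, 0 < β s) ∧ ∀ s ∈ Ico a b, B₁ s = √(β s) • C)

/-- Time regularity of the delayed damping operator on `[a, b)`: it extends to an element of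
`C([a, b]; L(U₂, H))`. -/
def RegularB₂ (B₂ : ℝ → U₂ →L[ℝ] H) (a b : ℝ) : Prop :=
  ∃ F : ℝ → U₂ →L[ℝ] H, ContinuousOn F (Icc a b) ∧ ∀ s ∈ Ico a b, B₂ s = F s

/-- `g = B₁* u_t` in `L²(a, b; U₁)`. As `u_t` is only `H`-valued while `B₁(s)*` is defined on `V`,
this is understood as the time derivative of the `U₁`-valued output:
`B₁(s)* (u(s + h) - u(s)) / h → g(s)` strongly in `L²` as `h → 0⁺`. If `B₁(s) = √(β(s)) C`,
it says that `C* u ∈ H¹(a, b; U₁)` and `g = √β (C* u)_t`; if `B₁` is bounded,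
`g` is just `B₁(s)* u_t(s)` almost everywhere. -/
def IsDampingTrace {A : PosOp H} (B₁ : ℝ → U₁ →L[ℝ] StrongDual ℝ A.V) (a b : ℝ)
    (u : ℝ → A.V) (g : ℝ → U₁) : Prop :=
  MemLp g 2 (volume.restrict (Ioc a b)) ∧
  Tendsto (fun h : ℝ => ∫⁻ s in Ioc a (b - h),
    ‖h⁻¹ • dualOp (B₁ s) (u (s + h) - u s) - g s‖ₑ ^ 2) (𝓝[>] 0) (𝓝 0)

/-- `w` is a weak solution on `[a, b]` of the undelayed damped equation
`w_tt + A w + B₁(s) B₁(s)* w_t = 0`, with `w_t = v`, `B₁* w_t = g`: the equation holds in `V'`,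
integrated in time. The initial data are `w a` and `v a`. -/
structure IsDampedSol (A : PosOp H) (B₁ : ℝ → U₁ →L[ℝ] StrongDual ℝ A.V) (a b : ℝ)
    (w : ℝ → A.V) (v : ℝ → H) (g : ℝ → U₁) : Prop where
  cont_w : ContinuousOn w (Icc a b)
  cont_v : ContinuousOn v (Icc a b)
  deriv : ∀ s ∈ Icc a b, HasDerivWithinAt (fun r => A.incl (w r)) (v s) (Icc a b) s
  trace : IsDampingTrace B₁ a b w g
  eqn : ∀ φ : A.V, ∀ s ∈ Icc a b, ⟪v s, A.incl φ⟫ - ⟪v a, A.incl φ⟫ +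
    ∫ r in a..s, (⟪w r, φ⟫ + ⟪g r, dualOp (B₁ r) φ⟫) = 0

/-- `u ∈ C([0, ∞); V) ∩ C¹([0, ∞); H)`, with `u_t = v`, is a weak solution on `[0, ∞)` of
`u_tt(s) + A u(s) + B₁(s) B₁(s)* u_t(s) + B₂(s) B₂(s)* u_t(s - τ) = 0`, where `t n` are the
switching times, the undelayed damping acting on the intervals `[t (2n), t (2n+1))`.
The initial data are `u 0` and `v 0`. -/
structure IsSol (A : PosOp H) (B₁ : ℝ → U₁ →L[ℝ] StrongDual ℝ A.V) (B₂ : ℝ → U₂ →L[ℝ] H)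
    (τ : ℝ) (t : ℕ → ℝ) (u : ℝ → A.V) (v : ℝ → H) : Prop where
  cont_u : ContinuousOn u (Ici 0)
  cont_v : ContinuousOn v (Ici 0)
  deriv : ∀ s ∈ Ici (0 : ℝ), HasDerivWithinAt (fun r => A.incl (u r)) (v s) (Ici 0) s
  eqn : ∃ g : ℝ → U₁, (∀ n, IsDampingTrace B₁ (t (2 * n)) (t (2 * n + 1)) u g) ∧
    ∀ φ : A.V, ∀ s ∈ Ici (0 : ℝ), ⟪v s, A.incl φ⟫ - ⟪v 0, A.incl φ⟫ +
      ∫ r in 0..s, (⟪u r, φ⟫ + ⟪g r, dualOp (B₁ r) φ⟫ +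
        ⟪(B₂ r).adjoint (v (r - τ)), (B₂ r).adjoint (A.incl φ)⟫) = 0

/-- The observability inequality for the undelayed damped equation on `[a, b]`, observed up to the
time `a + T` and with the constant `d`:
`E_S(a + T) ≤ d ∫_a^{a+T} ‖B₁* w_t‖²` for all weak solutions `w`. -/
def Observable (A : PosOp H) (B₁ : ℝ → U₁ →L[ℝ] StrongDual ℝ A.V) (a b T d : ℝ) : Prop :=
  ∀ (w : ℝ → A.V) (v : ℝ → H) (g : ℝ → U₁), IsDampedSol A B₁ a b w v g →
    A.energy (w (a + T)) (v (a + T)) ≤ d * ∫ s in a..(a + T), ‖g s‖ ^ 2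

end Damping

end DelayDamping

end

open DelayDamping

/-! The argument runs over one period `[t (2n), t (2n+2)]` of length `Tstar + Ttilde`, with `E` the
energy and `a = t (2n)`, `b = t (2n+1)`. On `[a, b]` the energy identity `E(a) - E(b) = ∫ ‖B₁*
u_t‖²` turns observability into `E(b) ≤ d (E(a) - E(b))`, that is `E(b) ≤ d / (d + 1) * E(a)`; it
also shows that `E ≤ E(a)` on `[a, b]`. On the delayed interval the argument `s - τ` lies in `[a,
b]`, because `Ttilde ≤ τ ≤ Tstar`. The delayed velocity is therefore controlled by `E(a)`, and
Cauchy–Schwarz with the bound `K = C * M (2n+1)` gives `E' ≤ K (E + E(a))`. Gronwall for `E + E(a)`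
yields `E ≤ (exp (K * Ttilde) * (d / (d + 1) + 1) - 1) * E(a) ≤ q * E(a)`, with `q < 1` the supremum
in the hypothesis. Geometric decay along periods is exponential decay.

The work lies in the energy identity for weak solutions: `u_t` takes values in `H` only, so it is
not an admissible test function. `PosOp.energy_sub_energy_of_lt` tests instead with the `V`-valued
difference quotient, obtains an exact identity for the time averages of the solution, and lets the
step tend to zero. The limit of the damping term is `tendsto_integral_average`. The delayed estimate
is `PosOp.energy_add_le_of_delayed`, and `IsSol.restrict` localizes the global equation to the
switching intervals. -/

namespace DelayDamping

/-! ### Completeness of `V` -/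

/-- Completeness allows `V`-valued primitives to be differentiated. A Cauchy sequence in `V`
converges in `H` together with its image under `A.sqrt`, and a self-adjoint operator has closed
graph. -/
instance PosOp.completeSpace {H : Type*} [NormedAddCommGroup H] [InnerProductSpace ℝ H]
    [CompleteSpace H] (A : PosOp H) : CompleteSpace A.V := by
  refine Metric.complete_of_cauchySeq_tendsto fun u hu => ?_
  let S : A.V →ₗᵢ[ℝ] H := ⟨A.sqrtV, fun x => (A.norm_V x).symm⟩
  obtain ⟨p, hp⟩ := cauchySeq_tendsto_of_complete (A.incl.uniformContinuous.comp_cauchySeq hu)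
  obtain ⟨q, hq⟩ := cauchySeq_tendsto_of_complete (S.isometry.uniformContinuous.comp_cauchySeq hu)
  have hmem : (p, q) ∈ A.sqrt.graph :=
    (A.sqrt_spec.1.isClosed : IsClosed (A.sqrt.graph : Set (H × H))).mem_of_tendsto
      (hp.prodMk_nhds hq) (Eventually.of_forall fun n => A.sqrt.mem_graph (u n))
  obtain ⟨x, -, hx⟩ := (LinearPMap.mem_graph_iff _).1 hmem
  refine ⟨(x : A.V), ?_⟩
  refine S.isometry.isEmbedding.isInducing.tendsto_nhds_iff.2 ?_
  have hx' : S x = q := hx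
  rw [hx']
  exact hq

/-! ### Translations and products in `L²` -/

/-- Translations form a continuous family of measure-preserving maps, hence act strongly
continuously on `L²`. -/
theorem tendsto_eLpNorm_translate_sub {E : Type*} [NormedAddCommGroup E] {g : ℝ → E}
    (hg : MemLp g 2 volume) :
    Tendsto (fun ρ : ℝ => eLpNorm (fun s => g (s + ρ) - g s) 2 volume) (𝓝 0) (𝓝 0) := by
  let T : C(ℝ, C(ℝ, ℝ)) := ContinuousMap.curry ⟨fun p : ℝ × ℝ => p.2 + p.1, by fun_prop⟩
  have hT : ∀ ρ, MeasurePreserving (T ρ) volume volume := fun ρ =>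
    measurePreserving_add_right volume ρ
  have h := Tendsto.compMeasurePreservingLp (p := 2) (ν := volume) (μ := volume)
    (tendsto_const_nhds (x := hg.toLp g) (f := 𝓝 (0 : ℝ))) (T.continuous.tendsto 0) hT (hT 0)
    (by norm_num)
  rw [tendsto_iff_edist_tendsto_0] at h
  refine h.congr fun ρ => ?_
  rw [Lp.edist_def]
  refine eLpNorm_congr_ae ?_
  have h0 : ⇑(Lp.compMeasurePreserving (T 0) (hT 0) (hg.toLp g)) =ᵐ[volume] g := by
    refine (Lp.coeFn_compMeasurePreserving _ _).trans ?_
    have : ⇑(T 0) = id := by ext x; simp [T]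
    rw [this]
    exact hg.coeFn_toLp
  have h1 : ⇑(Lp.compMeasurePreserving (T ρ) (hT ρ) (hg.toLp g)) =ᵐ[volume] g ∘ T ρ :=
    (Lp.coeFn_compMeasurePreserving _ _).trans
      ((hT ρ).quasiMeasurePreserving.ae_eq_comp hg.coeFn_toLp)
  filter_upwards [h0, h1] with s hs0 hs1
  simp only [Pi.sub_apply, hs0, hs1]
  rfl

theorem lintegral_enorm_mul_enorm_le {α E F : Type*} [MeasurableSpace α] {μ : Measure α}
    [NormedAddCommGroup E] [NormedAddCommGroup F] {f : α → E} {g : α → F}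
    (hf : AEStronglyMeasurable f μ) (hg : AEStronglyMeasurable g μ) :
    ∫⁻ x, ‖f x‖ₑ * ‖g x‖ₑ ∂μ ≤ eLpNorm f 2 μ * eLpNorm g 2 μ := by
  have h := eLpNorm_le_eLpNorm_mul_eLpNorm_of_nnnorm (p := 2) (q := 2) (r := 1) hf hg
    (fun x y => ‖x‖ * ‖y‖) 1 (Eventually.of_forall fun x => by simp)
  rw [eLpNorm_one_eq_lintegral_enorm] at h
  simpa using h

/-! ### Difference quotients -/

section DiffQuot

variable {E : Type*} [NormedAddCommGroup E] [NormedSpace ℝ E] {f f' : ℝ → E} {a b c h s : ℝ}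

theorem continuousOn_diffQuot (hf : ContinuousOn f (Icc a b)) (hh : 0 ≤ h) (hc : c + h ≤ b) :
    ContinuousOn (fun r => h⁻¹ • (f (r + h) - f r)) (Icc a c) := by
  have h1 : MapsTo (fun r => r + h) (Icc a c) (Icc a b) := fun r hr =>
    ⟨by linarith [hr.1], by linarith [hr.2]⟩
  exact ((hf.comp (by fun_prop) h1).sub
    (hf.mono (Icc_subset_Icc_right (by linarith)))).const_smul _

theorem hasDerivWithinAt_diffQuot
    (hf : ∀ s ∈ Icc a b, HasDerivWithinAt f (f' s) (Icc a b) s) (hh : 0 ≤ h) (hc : c + h ≤ b)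
    (hs : s ∈ Icc a c) :
    HasDerivWithinAt (fun r => h⁻¹ • (f (r + h) - f r)) (h⁻¹ • (f' (s + h) - f' s))
      (Icc a c) s := by
  have h1 : MapsTo (fun r => r + h) (Icc a c) (Icc a b) := fun r hr =>
    ⟨by linarith [hr.1], by linarith [hr.2]⟩
  have h2 := (hf (s + h) (h1 hs)).scomp s ((hasDerivWithinAt_id s (Icc a c)).add_const h) h1
  rw [one_smul] at h2
  exact (h2.sub ((hf s ⟨hs.1, by linarith [hs.2]⟩).mono
    (Icc_subset_Icc_right (by linarith)))).const_smul _

theorem tendsto_diffQuot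
    (hf : ∀ s ∈ Icc a b, HasDerivWithinAt f (f' s) (Icc a b) s) (hs : s ∈ Ico a b) :
    Tendsto (fun h : ℝ => h⁻¹ • (f (s + h) - f s)) (𝓝[>] 0) (𝓝 (f' s)) := by
  have h1 : HasDerivWithinAt f (f' s) (Ioi s) s :=
    (hf s ⟨hs.1, hs.2.le⟩).mono_of_mem_nhdsWithin
      (mem_of_superset (Ioc_mem_nhdsGT hs.2) fun r hr => ⟨hs.1.trans hr.1.le, hr.2⟩)
  have h2 : Tendsto (fun h : ℝ => s + h) (𝓝[>] 0) (𝓝[>] s) := by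
    refine tendsto_nhdsWithin_iff.2 ⟨?_, ?_⟩
    · exact ((continuous_const_add s).tendsto' 0 s (add_zero s)).mono_left nhdsWithin_le_nhds
    · filter_upwards [self_mem_nhdsWithin] with h hh
      exact lt_add_of_pos_right s hh
  refine (((hasDerivWithinAt_iff_tendsto_slope' self_notMem_Ioi).1 h1).comp h2).congr fun h => ?_
  simp [slope_def_module]

theorem norm_diffQuot_le {M : ℝ}
    (hf : ∀ s ∈ Icc a b, HasDerivWithinAt f (f' s) (Icc a b) s)
    (hM : ∀ s ∈ Icc a b, ‖f' s‖ ≤ M) (hh : 0 < h) (hs : a ≤ s) (hsb : s + h ≤ b) :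
    ‖h⁻¹ • (f (s + h) - f s)‖ ≤ M := by
  have h1 := (convex_Icc a b).norm_image_sub_le_of_norm_hasDerivWithin_le hf hM
    (x := s) (y := s + h) ⟨hs, by linarith⟩ ⟨by linarith, hsb⟩
  rw [norm_smul, norm_inv, Real.norm_of_nonneg hh.le]
  rw [add_sub_cancel_left, Real.norm_of_nonneg hh.le] at h1
  rw [inv_mul_le_iff₀ hh]
  linarith

end DiffQuot

/-! ### Convergence of averaged products -/

theorem integrable_inner {α U : Type*} [MeasurableSpace α] {μ : Measure α}
    [NormedAddCommGroup U] [InnerProductSpace ℝ U] {f g : α → U} (hf : MemLp f 2 μ)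
    (hg : MemLp g 2 μ) : Integrable (fun x => ⟪f x, g x⟫) μ := by
  refine memLp_one_iff_integrable.1 (hf.of_bilin (q := 2) (fun x y => ⟪x, y⟫) 1 hg
    (hf.1.inner hg.1) (Eventually.of_forall fun x => ?_))
  rw [one_mul]
  exact nnnorm_inner_le_nnnorm (𝕜 := ℝ) _ _

/-- Three-term telescoping and Cauchy–Schwarz. In the application `g₁` is a translate of `g`, while
`X` and `Y` are `N s` and `N (s + ρ)` applied to a difference quotient. The factor of `ε` involves
only `g`, `z` and `M`, so it is uniform in the step and the shift. -/
theorem lintegral_enorm_inner_sub_inner_le {α U : Type*} [MeasurableSpace α] {μ : Measure α}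
    [NormedAddCommGroup U] [InnerProductSpace ℝ U] {g₁ g X Y z : α → U} {M : ℝ} {ε : ℝ≥0}
    (hg₁ : AEStronglyMeasurable g₁ μ) (hg : AEStronglyMeasurable g μ)
    (hX : AEStronglyMeasurable X μ) (hY : AEStronglyMeasurable Y μ)
    (hz : AEStronglyMeasurable z μ) (hXY : ∀ᵐ s ∂μ, ‖Y s - X s‖ ≤ ε * (M + ‖X s‖))
    (hε : ε ≤ 1) (h₁ : eLpNorm (fun s => g₁ s - g s) 2 μ ≤ ε)
    (h₂ : eLpNorm (fun s => X s - z s) 2 μ ≤ ε) :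
    ∫⁻ s, ‖⟪g₁ s, Y s⟫ - ⟪g s, z s⟫‖ₑ ∂μ ≤
      ε * ((eLpNorm g 2 μ + 1) * (eLpNorm (fun _ : α => M) 2 μ + (eLpNorm z 2 μ + 1)) +
        (eLpNorm z 2 μ + 1) + eLpNorm g 2 μ) := by
  have hε' : (ε : ENNReal) ≤ 1 := by exact_mod_cast hε
  have hg₁n : eLpNorm g₁ 2 μ ≤ eLpNorm g 2 μ + 1 := by
    have : g₁ = fun s => g s + (g₁ s - g s) := by ext s; abel
    rw [this]
    refine (eLpNorm_add_le hg (hg₁.sub hg) (by norm_num)).trans ?_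
    gcongr
    exact h₁.trans hε'
  have hXn : eLpNorm X 2 μ ≤ eLpNorm z 2 μ + 1 := by
    have : X = fun s => z s + (X s - z s) := by ext s; abel
    rw [this]
    refine (eLpNorm_add_le hz (hX.sub hz) (by norm_num)).trans ?_
    gcongr
    exact h₂.trans hε'
  have hYn : eLpNorm (fun s => Y s - X s) 2 μ ≤
      ε * (eLpNorm (fun _ : α => M) 2 μ + (eLpNorm z 2 μ + 1)) := by
    have h := eLpNorm_le_nnreal_smul_eLpNorm_of_ae_le_mul (f := fun s => Y s - X s)
      (g := fun s => M + ‖X s‖) (c := ε) (μ := μ) (by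
        filter_upwards [hXY] with s hs
        exact hs.trans (mul_le_mul_of_nonneg_left (Real.le_norm_self _) ε.2)) 2
    refine h.trans ?_
    rw [ENNReal.smul_def, smul_eq_mul]
    gcongr
    refine (eLpNorm_add_le aestronglyMeasurable_const hX.norm (by norm_num)).trans ?_
    rw [eLpNorm_norm]
    gcongr
  have hpt : ∀ s, ‖⟪g₁ s, Y s⟫ - ⟪g s, z s⟫‖ₑ ≤
      ‖g₁ s‖ₑ * ‖Y s - X s‖ₑ + ‖g₁ s - g s‖ₑ * ‖X s‖ₑ + ‖g s‖ₑ * ‖X s - z s‖ₑ := by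
    intro s
    have e : ⟪g₁ s, Y s⟫ - ⟪g s, z s⟫ =
        ⟪g₁ s, Y s - X s⟫ + ⟪g₁ s - g s, X s⟫ + ⟪g s, X s - z s⟫ := by
      simp only [inner_sub_left, inner_sub_right]; ring
    have hi : ∀ x y : U, ‖⟪x, y⟫‖ₑ ≤ ‖x‖ₑ * ‖y‖ₑ := fun x y => by
      simp only [enorm_eq_nnnorm]
      exact_mod_cast nnnorm_inner_le_nnnorm (𝕜 := ℝ) x y
    rw [e]
    exact (enorm_add_le _ _).trans (add_le_add ((enorm_add_le _ _).trans
      (add_le_add (hi _ _) (hi _ _))) (hi _ _))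
  have hm₁ : AEStronglyMeasurable (fun s => Y s - X s) μ := hY.sub hX
  have hm₂ : AEStronglyMeasurable (fun s => g₁ s - g s) μ := hg₁.sub hg
  have hp₁ : AEMeasurable (fun s => ‖g₁ s‖ₑ * ‖Y s - X s‖ₑ) μ := hg₁.enorm.mul hm₁.enorm
  have hp₂ : AEMeasurable (fun s => ‖g₁ s - g s‖ₑ * ‖X s‖ₑ) μ := hm₂.enorm.mul hX.enorm
  calc ∫⁻ s, ‖⟪g₁ s, Y s⟫ - ⟪g s, z s⟫‖ₑ ∂μ
      ≤ ∫⁻ s, (‖g₁ s‖ₑ * ‖Y s - X s‖ₑ + ‖g₁ s - g s‖ₑ * ‖X s‖ₑ + ‖g s‖ₑ * ‖X s - z s‖ₑ) ∂μ :=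
        lintegral_mono hpt
    _ = ∫⁻ s, ‖g₁ s‖ₑ * ‖Y s - X s‖ₑ ∂μ + ∫⁻ s, ‖g₁ s - g s‖ₑ * ‖X s‖ₑ ∂μ +
        ∫⁻ s, ‖g s‖ₑ * ‖X s - z s‖ₑ ∂μ := by
        rw [lintegral_add_left' (f := fun s => ‖g₁ s‖ₑ * ‖Y s - X s‖ₑ + ‖g₁ s - g s‖ₑ * ‖X s‖ₑ)
          (hp₁.add hp₂), lintegral_add_left' hp₁]
    _ ≤ eLpNorm g₁ 2 μ * eLpNorm (fun s => Y s - X s) 2 μ +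
        eLpNorm (fun s => g₁ s - g s) 2 μ * eLpNorm X 2 μ +
        eLpNorm g 2 μ * eLpNorm (fun s => X s - z s) 2 μ :=
        add_le_add (add_le_add (lintegral_enorm_mul_enorm_le hg₁ hm₁)
          (lintegral_enorm_mul_enorm_le hm₂ hX)) (lintegral_enorm_mul_enorm_le hg (hX.sub hz))
    _ ≤ (eLpNorm g 2 μ + 1) * (ε * (eLpNorm (fun _ : α => M) 2 μ + (eLpNorm z 2 μ + 1))) +
        ε * (eLpNorm z 2 μ + 1) + eLpNorm g 2 μ * ε := by gcongr
    _ = _ := by ring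

variable {V H U : Type*} [NormedAddCommGroup V] [NormedSpace ℝ V] [NormedAddCommGroup H]
  [NormedSpace ℝ H] [NormedAddCommGroup U] [InnerProductSpace ℝ U]

/-- The modulus of continuity on `s` of a family of operators which need not be bounded for the
norm of `H`, relative to the graph norms. -/
def HasGraphModulus (N : ℝ → V →L[ℝ] U) (ι : V →L[ℝ] H) (s : Set ℝ) : Prop :=
  ∀ ε > 0, ∃ δ > 0, ∀ x ∈ s, ∀ y ∈ s, |y - x| ≤ δ →
    ∀ φ, ‖N y φ - N x φ‖ ≤ ε * (‖ι φ‖ + ‖N x φ‖)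

/-- Since `⟪g s, z s⟫` is its own average over `ρ ∈ (0, h]`, the difference is an average over
shifts. Tonelli exchanges `s` and `ρ`, leaving a bound needed for each fixed shift only. Strong
measurability of `g` makes `g (s + ρ)` jointly measurable. -/
theorem enorm_integral_average_sub_le {N : ℝ → V →L[ℝ] U} {D : ℝ → V} {g z : ℝ → U}
    {a b c h : ℝ} {κ : ENNReal} (hac : a ≤ c) (hh : 0 < h) (hcb : c + h ≤ b)
    (hN : ContinuousOn N (Icc a b)) (hD : ContinuousOn D (Icc a c))
    (hg : MemLp g 2 volume) (hgm : StronglyMeasurable g)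
    (hz : MemLp z 2 (volume.restrict (Ioc a c)))
    (hP : IntervalIntegrable (fun s => h⁻¹ * ∫ r in s..(s + h), ⟪g r, N r (D s)⟫) volume a c)
    (hκ : ∀ ρ ∈ Ioc 0 h,
      ∫⁻ s in Ioc a c, ‖⟪g (s + ρ), N (s + ρ) (D s)⟫ - ⟪g s, z s⟫‖ₑ ≤ κ) :
    ‖(∫ s in a..c, h⁻¹ * ∫ r in s..(s + h), ⟪g r, N r (D s)⟫) - ∫ s in a..c, ⟪g s, z s⟫‖ₑ ≤ κ := by
  have hgz : IntervalIntegrable (fun s => ⟪g s, z s⟫) volume a c := by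
    rw [intervalIntegrable_iff_integrableOn_Ioc_of_le hac]
    exact integrable_inner (hg.restrict _) hz
  rw [← intervalIntegral.integral_sub hP hgz, intervalIntegral.integral_of_le hac]
  refine (enorm_integral_le_lintegral_enorm _).trans ?_
  let K : ℝ × ℝ → ℝ := fun p => ⟪g (p.1 + p.2), N (p.1 + p.2) (D p.1)⟫ - ⟪g p.1, z p.1⟫
  have hpt : ∀ s ∈ Ioc a c, ‖(h⁻¹ * ∫ r in s..(s + h), ⟪g r, N r (D s)⟫) - ⟪g s, z s⟫‖ₑ ≤
      ENNReal.ofReal h⁻¹ * ∫⁻ ρ in Ioc 0 h, ‖K (s, ρ)‖ₑ := by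
    intro s hs
    have hsub : uIcc s (s + h) ⊆ Icc a b := by
      rw [uIcc_of_le (by linarith)]
      exact Icc_subset_Icc hs.1.le (by linarith [hs.2])
    have hint : IntervalIntegrable (fun r => ⟪g r, N r (D s)⟫) volume s (s + h) := by
      rw [intervalIntegrable_iff]
      have hcont : ContinuousOn (fun r => N r (D s)) (uIcc s (s + h)) :=
        (hN.mono hsub).clm_apply continuousOn_const
      have hmem : MemLp (fun r => N r (D s)) 2 (volume.restrict (uIoc s (s + h))) := by
        have : IsFiniteMeasure (volume.restrict (uIoc s (s + h))) := ⟨by simp [uIoc]⟩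
        obtain ⟨B, hB⟩ := isCompact_uIcc.exists_bound_of_continuousOn hcont
        refine MemLp.of_bound ((hcont.mono uIoc_subset_uIcc).aestronglyMeasurable
          measurableSet_uIoc) B ?_
        exact (ae_restrict_iff' measurableSet_uIoc).2
          (Eventually.of_forall fun r hr => hB r (uIoc_subset_uIcc hr))
      exact integrable_inner (hg.restrict _) hmem
    have e : (h⁻¹ * ∫ r in s..(s + h), ⟪g r, N r (D s)⟫) - ⟪g s, z s⟫ =
        h⁻¹ * ∫ ρ in Ioc 0 h, K (s, ρ) := by
      rw [← intervalIntegral.integral_of_le hh.le]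
      have h1 : ∫ ρ in (0 : ℝ)..h, K (s, ρ) =
          ∫ r in s..(s + h), (⟪g r, N r (D s)⟫ - ⟪g s, z s⟫) := by
        have := intervalIntegral.integral_comp_add_left
          (fun r => ⟪g r, N r (D s)⟫ - ⟪g s, z s⟫) s (a := 0) (b := h)
        rw [add_zero] at this
        exact this
      rw [h1, intervalIntegral.integral_sub hint (by simp), intervalIntegral.integral_const]
      simp only [add_sub_cancel_left, smul_eq_mul]
      field_simp
    rw [e, enorm_mul, Real.enorm_eq_ofReal (by positivity)]
    gcongr
    exact enorm_integral_le_lintegral_enorm _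
  have hKm : AEStronglyMeasurable K
      ((volume.restrict (Ioc a c)).prod (volume.restrict (Ioc 0 h))) := by
    refine AEStronglyMeasurable.sub ?_ ?_
    · refine AEStronglyMeasurable.inner ?_ ?_
      · exact (hgm.comp_measurable (measurable_fst.add measurable_snd)).aestronglyMeasurable
      · rw [Measure.prod_restrict]
        refine ContinuousOn.aestronglyMeasurable (s := Ioc a c ×ˢ Ioc 0 h) ?_
          (measurableSet_Ioc.prod measurableSet_Ioc)
        refine ContinuousOn.clm_apply ?_ ?_
        · refine hN.comp (by fun_prop) ?_
          rintro ⟨x, y⟩ ⟨hx, hy⟩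
          exact ⟨by linarith [hx.1, hy.1], by linarith [hx.2, hy.2]⟩
        · refine hD.comp (by fun_prop) ?_
          rintro ⟨x, y⟩ ⟨hx, hy⟩
          exact Ioc_subset_Icc_self hx
    · refine AEStronglyMeasurable.comp_fst (f := fun s => ⟪g s, z s⟫) ?_
      exact hgm.aestronglyMeasurable.inner hz.1
  calc ∫⁻ s in Ioc a c, ‖(h⁻¹ * ∫ r in s..(s + h), ⟪g r, N r (D s)⟫) - ⟪g s, z s⟫‖ₑ
      ≤ ∫⁻ s in Ioc a c, ENNReal.ofReal h⁻¹ * ∫⁻ ρ in Ioc 0 h, ‖K (s, ρ)‖ₑ :=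
        setLIntegral_mono' measurableSet_Ioc hpt
    _ = ENNReal.ofReal h⁻¹ * ∫⁻ ρ in Ioc 0 h, ∫⁻ s in Ioc a c, ‖K (s, ρ)‖ₑ := by
        rw [lintegral_const_mul' _ _ ENNReal.ofReal_ne_top,
          lintegral_lintegral_swap (f := fun s ρ => ‖K (s, ρ)‖ₑ) hKm.enorm]
    _ ≤ ENNReal.ofReal h⁻¹ * ∫⁻ _ in Ioc 0 h, κ := by
        gcongr ENNReal.ofReal h⁻¹ * ?_
        exact setLIntegral_mono' measurableSet_Ioc hκ
    _ = κ := by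
        rw [setLIntegral_const, Real.volume_Ioc, sub_zero, mul_comm κ, ← mul_assoc,
          ← ENNReal.ofReal_mul (by positivity), inv_mul_cancel₀ hh.ne', ENNReal.ofReal_one,
          one_mul]

/-- No bound on the `V`-norm of `D h s` is available as `h → 0`, so operator-norm continuity of `N`
does not suffice. What stays bounded is `ι (D h s)` in `H` and `N s (D h s)` in `L²`, exactly the
two terms in the graph modulus. -/
theorem tendsto_integral_average_of_stronglyMeasurable {N : ℝ → V →L[ℝ] U} {ι : V →L[ℝ] H}
    {D : ℝ → ℝ → V} {g z : ℝ → U} {a b c M : ℝ} (hac : a ≤ c) (hcb : c < b)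
    (hN : ContinuousOn N (Icc a b)) (hmod : HasGraphModulus N ι (Icc a b))
    (hD : ∀ h, 0 < h → c + h ≤ b → ContinuousOn (D h) (Icc a c))
    (hM : ∀ h, 0 < h → c + h ≤ b → ∀ s ∈ Icc a c, ‖ι (D h s)‖ ≤ M)
    (hg : MemLp g 2 volume) (hgm : StronglyMeasurable g)
    (hz : MemLp z 2 (volume.restrict (Ioc a c)))
    (hlim : Tendsto (fun h => eLpNorm (fun s => N s (D h s) - z s) 2 (volume.restrict (Ioc a c)))
      (𝓝[>] 0) (𝓝 0))
    (hP : ∀ h, 0 < h → c + h ≤ b → IntervalIntegrable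
      (fun s => h⁻¹ * ∫ r in s..(s + h), ⟪g r, N r (D h s)⟫) volume a c) :
    Tendsto (fun h => ∫ s in a..c, h⁻¹ * ∫ r in s..(s + h), ⟪g r, N r (D h s)⟫) (𝓝[>] 0)
      (𝓝 (∫ s in a..c, ⟪g s, z s⟫)) := by
  rw [tendsto_iff_edist_tendsto_0, ENNReal.tendsto_nhds_zero]
  intro η hη
  set μ := volume.restrict (Ioc a c)
  have hgμ : MemLp g 2 μ := hg.restrict _
  -- This constant does not depend on `h`; `ε` is then chosen with `ε ≤ 1` and `ε * κ ≤ η`.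
  set κ : ENNReal := (eLpNorm g 2 μ + 1) * (eLpNorm (fun _ : ℝ => M) 2 μ + (eLpNorm z 2 μ + 1)) +
    (eLpNorm z 2 μ + 1) + eLpNorm g 2 μ with hκ
  have hκt : κ ≠ ⊤ := by
    have h1 := hgμ.2.ne
    have h2 := hz.2.ne
    have h3 : eLpNorm (fun _ : ℝ => M) 2 μ ≠ ⊤ := (memLp_const M).2.ne
    finiteness
  obtain ⟨ε₀, hε₀, hlt⟩ := ENNReal.exists_nnreal_pos_mul_lt hκt hη.ne'
  set ε := min ε₀ 1
  have hε : 0 < ε := lt_min hε₀ one_pos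
  have hε1 : ε ≤ 1 := min_le_right _ _
  have hεκ : ε * κ ≤ η := le_trans (by gcongr; exact min_le_left _ _) hlt.le
  have hε' : (0 : ENNReal) < ε := by exact_mod_cast hε
  obtain ⟨δ, hδ, hmod⟩ := hmod ε (by exact_mod_cast hε)
  have htr := ENNReal.tendsto_nhds_zero.1 (tendsto_eLpNorm_translate_sub hg) ε hε'
  obtain ⟨δ', hδ', htr⟩ := Metric.eventually_nhds_iff.1 htr
  filter_upwards [ENNReal.tendsto_nhds_zero.1 hlim ε hε',
    Ioo_mem_nhdsGT (lt_min (lt_min hδ hδ') (sub_pos.2 hcb))] with h hlimh hh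
  have hh0 : 0 < h := hh.1
  have hhδ : h < δ := hh.2.trans_le ((min_le_left _ _).trans (min_le_left _ _))
  have hhδ' : h < δ' := hh.2.trans_le ((min_le_left _ _).trans (min_le_right _ _))
  have hhb : c + h ≤ b := by linarith [hh.2.trans_le (min_le_right _ _)]
  rw [edist_eq_enorm_sub]
  refine (enorm_integral_average_sub_le hac hh0 hhb hN (hD h hh0 hhb) hg hgm hz (hP h hh0 hhb)
    (κ := ε * κ) fun ρ hρ => ?_).trans hεκ
  have hsub : Ioc a c ⊆ Icc a c := Ioc_subset_Icc_self
  refine lintegral_enorm_inner_sub_inner_le (X := fun s => N s (D h s)) ?_ hgμ.1 ?_ ?_ hz.1 ?_ hε1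
    ?_ hlimh
  · exact (hgm.comp_measurable (measurable_add_const ρ)).aestronglyMeasurable
  · refine ContinuousOn.aestronglyMeasurable ?_ measurableSet_Ioc
    exact (hN.mono (hsub.trans (Icc_subset_Icc_right hcb.le))).clm_apply
      ((hD h hh0 hhb).mono hsub)
  · refine ContinuousOn.aestronglyMeasurable ?_ measurableSet_Ioc
    refine ContinuousOn.clm_apply (hN.comp (by fun_prop) fun s hs => ?_)
      ((hD h hh0 hhb).mono hsub)
    exact ⟨by linarith [hs.1, hρ.1], by linarith [hs.2, hρ.2]⟩
  · refine (ae_restrict_iff' measurableSet_Ioc).2 (Eventually.of_forall fun s hs => ?_)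
    refine (hmod s ⟨hs.1.le, by linarith [hs.2]⟩ (s + ρ)
      ⟨by linarith [hs.1, hρ.1], by linarith [hs.2, hρ.2]⟩ ?_ _).trans ?_
    · rw [add_sub_cancel_left, abs_of_pos hρ.1]
      exact hρ.2.trans hhδ.le
    · gcongr
      exact hM h hh0 hhb s (hsub hs)
  · refine le_trans (eLpNorm_mono_measure _ Measure.restrict_le_self) (htr ?_)
    rw [Real.dist_eq, sub_zero, abs_of_pos hρ.1]
    exact hρ.2.trans_lt hhδ'

/-- Reduction to a measurable representative of `g` extended by zero to the line. The condition `c +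
h ≤ b` keeps all averaging windows inside `[a, b]`, where the change is invisible to the integrals.
-/
theorem tendsto_integral_average {N : ℝ → V →L[ℝ] U} {ι : V →L[ℝ] H}
    {D : ℝ → ℝ → V} {g z : ℝ → U} {a b c M : ℝ} (hac : a ≤ c) (hcb : c < b)
    (hN : ContinuousOn N (Icc a b)) (hmod : HasGraphModulus N ι (Icc a b))
    (hD : ∀ h, 0 < h → c + h ≤ b → ContinuousOn (D h) (Icc a c))
    (hM : ∀ h, 0 < h → c + h ≤ b → ∀ s ∈ Icc a c, ‖ι (D h s)‖ ≤ M)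
    (hg : MemLp g 2 (volume.restrict (Ioc a b)))
    (hz : MemLp z 2 (volume.restrict (Ioc a c)))
    (hlim : Tendsto (fun h => eLpNorm (fun s => N s (D h s) - z s) 2 (volume.restrict (Ioc a c)))
      (𝓝[>] 0) (𝓝 0))
    (hP : ∀ h, 0 < h → c + h ≤ b → IntervalIntegrable
      (fun s => h⁻¹ * ∫ r in s..(s + h), ⟪g r, N r (D h s)⟫) volume a c) :
    Tendsto (fun h => ∫ s in a..c, h⁻¹ * ∫ r in s..(s + h), ⟪g r, N r (D h s)⟫) (𝓝[>] 0)
      (𝓝 (∫ s in a..c, ⟪g s, z s⟫)) := by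
  set g' : ℝ → U := (Ioc a b).indicator (hg.1.mk g)
  have hgm : StronglyMeasurable g' := hg.1.stronglyMeasurable_mk.indicator measurableSet_Ioc
  have hae : ∀ᵐ s, s ∈ Ioc a b → g' s = g s := by
    filter_upwards [(ae_restrict_iff' measurableSet_Ioc).1 hg.1.ae_eq_mk] with s hs hsab
    rw [hs hsab]
    exact indicator_of_mem hsab _
  have hg' : MemLp g' 2 volume := by
    rw [memLp_indicator_iff_restrict measurableSet_Ioc]
    exact (memLp_congr_ae hg.1.ae_eq_mk).1 hg
  have hin : ∀ h, 0 < h → c + h ≤ b → ∀ s ∈ Icc a c,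
      ∫ r in s..(s + h), ⟪g' r, N r (D h s)⟫ = ∫ r in s..(s + h), ⟪g r, N r (D h s)⟫ := by
    intro h hh hhb s hs
    refine intervalIntegral.integral_congr_ae ?_
    filter_upwards [hae] with r hr hrs
    rw [uIoc_of_le (by linarith)] at hrs
    rw [hr ⟨hs.1.trans_lt hrs.1, by linarith [hrs.2, hs.2]⟩]
  have hout : ∫ s in a..c, ⟪g s, z s⟫ = ∫ s in a..c, ⟪g' s, z s⟫ := by
    refine intervalIntegral.integral_congr_ae ?_
    filter_upwards [hae] with r hr hrs
    rw [uIoc_of_le hac] at hrs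
    rw [hr ⟨hrs.1, hrs.2.trans hcb.le⟩]
  rw [hout]
  refine (tendsto_integral_average_of_stronglyMeasurable hac hcb hN hmod hD hM hg' hgm hz hlim
    fun h hh hhb => (hP h hh hhb).congr fun s hs => ?_).congr' ?_
  · rw [uIoc_of_le hac] at hs
    simp only [hin h hh hhb s (Ioc_subset_Icc_self hs)]
  · filter_upwards [Ioo_mem_nhdsGT (sub_pos.2 hcb)] with h hh
    refine intervalIntegral.integral_congr fun s hs => ?_
    rw [uIcc_of_le hac] at hs
    simp only [hin h hh.1 (by linarith [hh.2]) s hs]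

/-! ### The energy identity -/

section Energy

variable {H : Type*} [NormedAddCommGroup H] [InnerProductSpace ℝ H] [CompleteSpace H]
  {U : Type*} [NormedAddCommGroup U] [InnerProductSpace ℝ U]

theorem integrableOn_inner_clm {V : Type*} [NormedAddCommGroup V] [NormedSpace ℝ V]
    {N : ℝ → V →L[ℝ] U} {g : ℝ → U} {a b : ℝ} (hN : ContinuousOn N (Icc a b))
    (hg : MemLp g 2 (volume.restrict (Ioc a b))) (φ : V) :
    IntegrableOn (fun r => ⟪g r, N r φ⟫) (Ioc a b) := by
  have hcont : ContinuousOn (fun r => N r φ) (Icc a b) := hN.clm_apply continuousOn_const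
  obtain ⟨B, hB⟩ := isCompact_Icc.exists_bound_of_continuousOn hcont
  refine integrable_inner hg (MemLp.of_bound ((hcont.mono
    Ioc_subset_Icc_self).aestronglyMeasurable measurableSet_Ioc) B ?_)
  exact (ae_restrict_iff' measurableSet_Ioc).2
    (Eventually.of_forall fun r hr => hB r (Ioc_subset_Icc_self hr))

/-- The Steklov averages `h⁻¹ • (Ω (s + h) - Ω s)` have the `V`-valued derivative `D h s`, so their
energy `E h` can be differentiated classically. The strict inequality `c < b` leaves room for the
forward window. -/
theorem PosOp.energy_sub_energy_of_lt (A : PosOp H) {N : ℝ → A.V →L[ℝ] U} {g z : ℝ → U}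
    {w : ℝ → A.V} {v : ℝ → H} {a b c : ℝ} (hac : a ≤ c) (hcb : c < b)
    (hN : ContinuousOn N (Icc a b)) (hmod : HasGraphModulus N A.incl (Icc a b))
    (hw : ContinuousOn w (Icc a b)) (hv : ContinuousOn v (Icc a b))
    (hderiv : ∀ s ∈ Icc a b, HasDerivWithinAt (fun r => A.incl (w r)) (v s) (Icc a b) s)
    (hg : MemLp g 2 (volume.restrict (Ioc a b)))
    (hz : MemLp z 2 (volume.restrict (Ioc a c)))
    (hlim : Tendsto (fun h : ℝ => eLpNorm (fun s => N s (h⁻¹ • (w (s + h) - w s)) - z s) 2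
      (volume.restrict (Ioc a c))) (𝓝[>] 0) (𝓝 0))
    (heqn : ∀ φ : A.V, ∀ s ∈ Icc a b, ⟪v s, A.incl φ⟫ - ⟪v a, A.incl φ⟫ +
      ∫ r in a..s, (⟪w r, φ⟫ + ⟪g r, N r φ⟫) = 0) :
    A.energy (w c) (v c) - A.energy (w a) (v a) = -∫ s in a..c, ⟪g s, z s⟫ := by
  have hab : a < b := hac.trans_lt hcb
  set D : ℝ → ℝ → A.V := fun h s => h⁻¹ • (w (s + h) - w s) with hDdef
  set Ω : ℝ → A.V := fun s => ∫ r in a..s, w r with hΩdef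
  have hwi : ∀ s ∈ Icc a b, ∀ s' ∈ Icc a b, IntervalIntegrable w volume s s' := fun s hs s' hs' =>
    (hw.mono (uIcc_subset_Icc hs hs')).intervalIntegrable
  have ha : a ∈ Icc a b := ⟨le_rfl, hab.le⟩
  have hΩ : ∀ s ∈ Icc a b, HasDerivWithinAt Ω (w s) (Icc a b) s := by
    intro s hs
    have : Fact (s ∈ Icc a b) := ⟨hs⟩
    exact intervalIntegral.integral_hasDerivWithinAt_right (hwi a ha s hs)
      (hw.stronglyMeasurableAtFilter_nhdsWithin measurableSet_Icc s) (hw s hs)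
  have hιD : ∀ h s, A.incl (D h s) = h⁻¹ • (A.incl (w (s + h)) - A.incl (w s)) := fun h s => by
    simp only [hDdef, map_smul, map_sub]
  have hint : ∀ φ : A.V, ∀ s ∈ Icc a b, ∀ s' ∈ Icc a b,
      IntervalIntegrable (fun r => ⟪w r, φ⟫) volume s s' ∧
      IntervalIntegrable (fun r => ⟪g r, N r φ⟫) volume s s' := by
    intro φ s hs s' hs'
    refine ⟨((hw.mono (uIcc_subset_Icc hs hs')).inner continuousOn_const).intervalIntegrable, ?_⟩
    rw [intervalIntegrable_iff]
    refine (integrableOn_inner_clm hN hg φ).mono_set ?_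
    exact Ioc_subset_Ioc (le_min hs.1 hs'.1) (max_le hs.2 hs'.2)
  set E : ℝ → ℝ → ℝ := fun h s =>
    (‖h⁻¹ • (Ω (s + h) - Ω s)‖ ^ 2 + ‖h⁻¹ • (A.incl (w (s + h)) - A.incl (w s))‖ ^ 2) / 2 with hE
  set P : ℝ → ℝ → ℝ := fun h s => h⁻¹ * ∫ r in s..(s + h), ⟪g r, N r (D h s)⟫ with hPdef
  set Q : ℝ → ℝ → ℝ := fun h s => ⟪h⁻¹ • (Ω (s + h) - Ω s), h⁻¹ • (w (s + h) - w s)⟫ +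
    ⟪h⁻¹ • (A.incl (w (s + h)) - A.incl (w s)), h⁻¹ • (v (s + h) - v s)⟫ with hQ
  have hEQ : ∀ h, 0 < h → c + h ≤ b → ∀ s ∈ Icc a c,
      HasDerivWithinAt (E h) (Q h s) (Icc a c) s := by
    intro h hh hhb s hs
    have h1 := (hasDerivWithinAt_diffQuot hΩ hh.le hhb hs).norm_sq
    have h2 := (hasDerivWithinAt_diffQuot hderiv hh.le hhb hs).norm_sq
    refine ((h1.add h2).div_const 2).congr_deriv ?_
    rw [hQ]
    ring
  -- The equations at `s + h` and at `s` are subtracted, both tested with the frozen vector `D h s`.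
  have hQP : ∀ h, 0 < h → c + h ≤ b → ∀ s ∈ Icc a c, Q h s = -P h s := by
    intro h hh hhb s hs
    have hs1 : s ∈ Icc a b := ⟨hs.1, hs.2.trans hcb.le⟩
    have hs2 : s + h ∈ Icc a b := ⟨by linarith [hs.1], by linarith [hs.2]⟩
    have e1 := heqn (D h s) _ hs1
    have e2 := heqn (D h s) _ hs2
    have e3 := intervalIntegral.integral_interval_sub_left
      ((hint (D h s) a ha _ hs2).1.add (hint (D h s) a ha _ hs2).2)
      ((hint (D h s) a ha _ hs1).1.add (hint (D h s) a ha _ hs1).2)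
    rw [intervalIntegral.integral_add (hint (D h s) s hs1 _ hs2).1
      (hint (D h s) s hs1 _ hs2).2] at e3
    have e4 : ∫ r in s..(s + h), ⟪w r, D h s⟫ = ⟪Ω (s + h) - Ω s, D h s⟫ := by
      rw [hΩdef, intervalIntegral.integral_interval_sub_left (hwi a ha _ hs2) (hwi a ha _ hs1),
        real_inner_comm]
      have := (innerSL ℝ (D h s)).intervalIntegral_comp_comm (hwi s hs1 _ hs2)
      simpa only [innerSL_apply_apply, real_inner_comm] using this
    rw [e4] at e3
    have e5 : Q h s = h⁻¹ * (⟪Ω (s + h) - Ω s, D h s⟫ +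
        (⟪v (s + h), A.incl (D h s)⟫ - ⟪v s, A.incl (D h s)⟫)) := by
      rw [mul_add, ← real_inner_smul_left, ← inner_sub_left, real_inner_comm _ (v (s + h) - v s),
        ← real_inner_smul_right, hιD]
    rw [e5, hPdef]
    simp only
    rw [← mul_neg]
    congr 1
    linarith
  have hQc : ∀ h, 0 < h → c + h ≤ b → ContinuousOn (Q h) (Icc a c) := by
    intro h hh hhb
    have hΩc : ContinuousOn Ω (Icc a b) := fun s hs => (hΩ s hs).continuousWithinAt
    have hιc : ContinuousOn (fun s => A.incl (w s)) (Icc a b) :=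
      A.incl.continuous.comp_continuousOn hw
    exact ((continuousOn_diffQuot hΩc hh.le hhb).inner (continuousOn_diffQuot hw hh.le hhb)).add
      ((continuousOn_diffQuot hιc hh.le hhb).inner (continuousOn_diffQuot hv hh.le hhb))
  have hEint : ∀ h, 0 < h → c + h ≤ b → -∫ s in a..c, P h s = E h c - E h a := by
    intro h hh hhb
    rw [← intervalIntegral.integral_eq_sub_of_hasDerivAt_of_le hac
      (fun s hs => (hEQ h hh hhb s hs).continuousWithinAt)
      (fun s hs => (hEQ h hh hhb s (Ioo_subset_Icc_self hs)).hasDerivAt (Icc_mem_nhds hs.1 hs.2))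
      ((hQc h hh hhb).intervalIntegrable_of_Icc hac), ← intervalIntegral.integral_neg]
    refine intervalIntegral.integral_congr fun s hs => ?_
    rw [uIcc_of_le hac] at hs
    exact (hQP h hh hhb s hs).symm
  obtain ⟨M, hM⟩ := isCompact_Icc.exists_bound_of_continuousOn hv
  have hPlim : Tendsto (fun h => ∫ s in a..c, P h s) (𝓝[>] 0) (𝓝 (∫ s in a..c, ⟪g s, z s⟫)) := by
    refine tendsto_integral_average (M := M) hac hcb hN hmod ?_ ?_ hg hz hlim ?_
    · intro h hh hhb
      exact continuousOn_diffQuot hw hh.le hhb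
    · intro h hh hhb s hs
      rw [hιD]
      exact norm_diffQuot_le hderiv hM hh hs.1 (by linarith [hs.2])
    -- Integrability of the averaged damping term is inherited from the continuous function `Q h`,
    -- as `P h = -Q h` on `[a, c]`.
    · intro h hh hhb
      refine ((hQc h hh hhb).intervalIntegrable_of_Icc hac).neg.congr fun s hs => ?_
      rw [uIoc_of_le hac] at hs
      simp [hQP h hh hhb s (Ioc_subset_Icc_self hs), hPdef]
  have hElim : ∀ s ∈ Ico a b, Tendsto (fun h => E h s) (𝓝[>] 0) (𝓝 (A.energy (w s) (v s))) :=
    fun s hs => (((tendsto_diffQuot hΩ hs).norm.pow 2).add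
      ((tendsto_diffQuot hderiv hs).norm.pow 2)).div_const 2
  refine tendsto_nhds_unique ((hElim c ⟨hac, hcb⟩).sub (hElim a ⟨le_rfl, hab⟩))
    (hPlim.neg.congr' ?_)
  filter_upwards [Ioo_mem_nhdsGT (sub_pos.2 hcb)] with h hh
  exact hEint h hh.1 (by linarith [hh.2])

end Energy

theorem tendsto_eLpNorm_two_of_tendsto_lintegral {α ι E : Type*} [MeasurableSpace α]
    {μ : Measure α} [NormedAddCommGroup E] {l : Filter ι} {f : ι → α → E}
    (h : Tendsto (fun i => ∫⁻ x, ‖f i x‖ₑ ^ 2 ∂μ) l (𝓝 0)) :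
    Tendsto (fun i => eLpNorm (f i) 2 μ) l (𝓝 0) := by
  have e : ∀ i, eLpNorm (f i) 2 μ = (∫⁻ x, ‖f i x‖ₑ ^ 2 ∂μ) ^ (1 / 2 : ℝ) := fun i => by
    rw [eLpNorm_eq_lintegral_rpow_enorm_toReal (by norm_num) (by norm_num)]
    simp
  simp only [e]
  have h2 := (ENNReal.continuous_rpow_const (y := (1 / 2 : ℝ))).tendsto 0
  rw [ENNReal.zero_rpow_of_pos (by norm_num)] at h2
  exact h2.comp h

/-! ### Regularity of the damping operators -/

section Modulus

variable {H : Type*} [NormedAddCommGroup H] [NormedSpace ℝ H]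
  {U : Type*} [NormedAddCommGroup U] [InnerProductSpace ℝ U]
  {V : Type*} [NormedAddCommGroup V] [NormedSpace ℝ V]

theorem HasGraphModulus.congr {N N' : ℝ → V →L[ℝ] U} {ι : V →L[ℝ] H} {s : Set ℝ}
    (h : HasGraphModulus N ι s) (hN : EqOn N' N s) : HasGraphModulus N' ι s := by
  intro ε hε
  obtain ⟨δ, hδ, h⟩ := h ε hε
  refine ⟨δ, hδ, fun x hx y hy hxy φ => ?_⟩
  rw [hN hx, hN hy]
  exact h x hx y hy hxy φ

/-- For a scalar multiple of a fixed, possibly unbounded, operator the error is relative to `‖α x •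
L φ‖`. This needs a positive lower bound for `α`, supplied by its minimum over the compact set. -/
theorem hasGraphModulus_smul {α : ℝ → ℝ} {s : Set ℝ} (hs : IsCompact s) (hα : ContinuousOn α s)
    (hpos : ∀ x ∈ s, 0 < α x) (L : V →L[ℝ] U) (ι : V →L[ℝ] H) :
    HasGraphModulus (fun r => α r • L) ι s := by
  intro ε hε
  rcases s.eq_empty_or_nonempty with rfl | hne
  · exact ⟨1, one_pos, by simp⟩
  obtain ⟨x₀, hx₀, hmin⟩ := hs.exists_isMinOn hne hα
  obtain ⟨δ, hδ, h⟩ := Metric.uniformContinuousOn_iff_le.1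
    (hs.uniformContinuousOn_of_continuous hα) (ε * α x₀) (mul_pos hε (hpos _ hx₀))
  refine ⟨δ, hδ, fun x hx y hy hxy φ => ?_⟩
  have h1 : |α y - α x| ≤ ε * α x₀ := h y hy x hx hxy
  have h2 : α x₀ ≤ α x := hmin hx
  calc ‖α y • L φ - α x • L φ‖ = |α y - α x| * ‖L φ‖ := by
        rw [← sub_smul, norm_smul, Real.norm_eq_abs]
    _ ≤ ε * α x * ‖L φ‖ := by
        gcongr
        exact h1.trans (by gcongr)
    _ = ε * ‖α x • L φ‖ := by
        rw [norm_smul, Real.norm_of_nonneg (hpos x hx).le]; ring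
    _ ≤ ε * (‖ι φ‖ + ‖α x • L φ‖) := by
        gcongr
        linarith [norm_nonneg (ι φ)]

end Modulus

section Regularity

variable {H : Type*} [NormedAddCommGroup H] [InnerProductSpace ℝ H] [CompleteSpace H]
  {U : Type*} [NormedAddCommGroup U] [InnerProductSpace ℝ U] [CompleteSpace U]
  {V : Type*} [NormedAddCommGroup V] [NormedSpace ℝ V]

theorem continuousOn_adjoint_comp {F : ℝ → U →L[ℝ] H} {s : Set ℝ} (hF : ContinuousOn F s)
    (ι : V →L[ℝ] H) : ContinuousOn (fun r => (F r).adjoint ∘L ι) s :=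
  ((ContinuousLinearMap.adjoint (𝕜 := ℝ) (E := U) (F := H)).continuous.comp_continuousOn
    hF).clm_comp continuousOn_const

theorem hasGraphModulus_adjoint_comp {F : ℝ → U →L[ℝ] H} {s : Set ℝ} (hs : IsCompact s)
    (hF : ContinuousOn F s) (ι : V →L[ℝ] H) :
    HasGraphModulus (fun r => (F r).adjoint ∘L ι) ι s := by
  intro ε hε
  obtain ⟨δ, hδ, h⟩ := Metric.uniformContinuousOn_iff_le.1
    (hs.uniformContinuousOn_of_continuous hF) ε hε
  refine ⟨δ, hδ, fun x hx y hy hxy φ => ?_⟩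
  have h1 : ‖F y - F x‖ ≤ ε := by
    rw [← dist_eq_norm]
    exact h y hy x hx hxy
  calc ‖(F y).adjoint (ι φ) - (F x).adjoint (ι φ)‖ = ‖(F y - F x).adjoint (ι φ)‖ := by
        rw [map_sub]; rfl
    _ ≤ ‖(F y - F x).adjoint‖ * ‖ι φ‖ := ContinuousLinearMap.le_opNorm _ _
    _ ≤ ε * ‖ι φ‖ := by
        rw [LinearIsometryEquiv.norm_map]
        gcongr
    _ ≤ ε * (‖ι φ‖ + ‖(F x).adjoint (ι φ)‖) := by
        gcongr
        linarith [norm_nonneg ((F x).adjoint (ι φ))]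

theorem dualOp_pivot_comp {A : PosOp H} (F : U →L[ℝ] H) :
    dualOp (A.pivot ∘L F) = F.adjoint ∘L A.incl := by
  ext v
  refine ext_inner_right ℝ fun x => ?_
  rw [dualOp_inner, ContinuousLinearMap.comp_apply, ContinuousLinearMap.comp_apply,
    ContinuousLinearMap.adjoint_inner_left, A.pivot_apply, real_inner_comm]

theorem dualOp_smul {A : PosOp H} (c : ℝ) (B : U →L[ℝ] StrongDual ℝ A.V) :
    dualOp (c • B) = c • dualOp B := by
  ext v
  refine ext_inner_right ℝ fun x => ?_
  rw [_root_.smul_apply, real_inner_smul_left, dualOp_inner, dualOp_inner]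
  rfl

theorem dualOp_zero {A : PosOp H} : dualOp (0 : U →L[ℝ] StrongDual ℝ A.V) = 0 := by
  ext v
  refine ext_inner_right ℝ fun x => ?_
  rw [dualOp_inner]
  simp

/-- The interval stops at `c < b` because `β` may vanish at `b`, and `B₁ b` is not the limit of `B₁`
from the left. -/
theorem RegularB₁.continuousOn_and_hasGraphModulus {A : PosOp H}
    {B₁ : ℝ → U →L[ℝ] StrongDual ℝ A.V} {a b c : ℝ} (h : RegularB₁ A B₁ a b) (hc : c < b) :
    ContinuousOn (fun r => dualOp (B₁ r)) (Icc a c) ∧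
      HasGraphModulus (fun r => dualOp (B₁ r)) A.incl (Icc a c) := by
  have hsub : Icc a c ⊆ Icc a b := Icc_subset_Icc_right hc.le
  have hsub' : Icc a c ⊆ Ico a b := fun x hx => ⟨hx.1, hx.2.trans_lt hc⟩
  rcases h with ⟨F, hF, hB⟩ | ⟨β, L, ⟨β', K, hβ, -⟩, hpos, hB⟩
  · have hN : EqOn (fun r => dualOp (B₁ r)) (fun r => (F r).adjoint ∘L A.incl) (Icc a c) := by
      intro r hr
      simp only [hB r (hsub' hr), dualOp_pivot_comp]
    exact ⟨(continuousOn_adjoint_comp (hF.continuousOn.mono hsub) _).congr hN,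
      (hasGraphModulus_adjoint_comp isCompact_Icc (hF.continuousOn.mono hsub) _).congr hN⟩
  · have hN : EqOn (fun r => dualOp (B₁ r)) (fun r => √(β r) • dualOp L) (Icc a c) := by
      intro r hr
      simp only [hB r (hsub' hr), dualOp_smul]
    have hβc : ContinuousOn (fun r => √(β r)) (Icc a c) :=
      (ContinuousOn.sqrt fun s hs => (hβ s hs).continuousWithinAt).mono hsub
    exact ⟨(hβc.smul continuousOn_const).congr hN, (hasGraphModulus_smul isCompact_Icc hβc
      (fun x hx => Real.sqrt_pos.2 (hpos x (hsub' hx))) _ _).congr hN⟩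

end Regularity

section Intervals

variable {H : Type*} [NormedAddCommGroup H] [InnerProductSpace ℝ H] [CompleteSpace H]
  {U : Type*} [NormedAddCommGroup U] [InnerProductSpace ℝ U] [CompleteSpace U]

theorem PosOp.continuousOn_energy (A : PosOp H) {w : ℝ → A.V} {v : ℝ → H} {s : Set ℝ}
    (hw : ContinuousOn w s) (hv : ContinuousOn v s) :
    ContinuousOn (fun r => A.energy (w r) (v r)) s :=
  ((hw.norm.pow 2).add (hv.norm.pow 2)).div_const 2

theorem PosOp.energy_nonneg (A : PosOp H) (u : A.V) (v : H) : 0 ≤ A.energy u v := by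
  unfold PosOp.energy
  positivity

/-! ### Energy on the intervals with undelayed damping -/

/-- The definition of the trace says precisely that the limit `z` of the general identity is `g`
itself. -/
theorem IsDampedSol.energy_sub_energy {A : PosOp H} {B₁ : ℝ → U →L[ℝ] StrongDual ℝ A.V}
    {a b : ℝ} {w : ℝ → A.V} {v : ℝ → H} {g : ℝ → U} (hreg : RegularB₁ A B₁ a b) (hab : a < b)
    (hsol : IsDampedSol A B₁ a b w v g) {c : ℝ} (hc : c ∈ Icc a b) :
    A.energy (w c) (v c) - A.energy (w a) (v a) = -∫ s in a..c, ‖g s‖ ^ 2 := by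
  have hlt : EqOn (fun c => A.energy (w c) (v c) - A.energy (w a) (v a))
      (fun c => -∫ s in a..c, ‖g s‖ ^ 2) (Ico a b) := by
    intro c hc
    have hcb : c < (c + b) / 2 := by linarith [hc.2]
    have hbb : (c + b) / 2 < b := by linarith [hc.2]
    have hsub : Icc a ((c + b) / 2) ⊆ Icc a b := Icc_subset_Icc_right hbb.le
    obtain ⟨hN, hmod⟩ := hreg.continuousOn_and_hasGraphModulus hbb
    simp only [← real_inner_self_eq_norm_sq]
    refine A.energy_sub_energy_of_lt hc.1 hcb hN hmod (hsol.cont_w.mono hsub)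
      (hsol.cont_v.mono hsub) (fun s hs => (hsol.deriv s (hsub hs)).mono hsub)
      (hsol.trace.1.mono_measure (Measure.restrict_mono (Ioc_subset_Ioc_right hbb.le) le_rfl))
      (hsol.trace.1.mono_measure (Measure.restrict_mono (Ioc_subset_Ioc_right hc.2.le) le_rfl))
      (tendsto_eLpNorm_two_of_tendsto_lintegral ?_) (fun φ s hs => hsol.eqn φ s (hsub hs))
    refine tendsto_of_tendsto_of_tendsto_of_le_of_le' tendsto_const_nhds hsol.trace.2
      (Eventually.of_forall fun _ => zero_le) ?_
    filter_upwards [Ioo_mem_nhdsGT (sub_pos.2 hc.2)] with h hh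
    have : Ioc a c ⊆ Ioc a (b - h) := Ioc_subset_Ioc_right (by linarith [hh.2])
    refine (lintegral_mono_set this).trans_eq' ?_
    simp only [map_smul]
  -- Both sides are continuous on `[a, b]`, so the identity on `[a, b)` extends to the endpoint.
  refine hlt.of_subset_closure (t := Icc a b) ?_ ?_ Ico_subset_Icc_self ?_ hc
  · exact (A.continuousOn_energy hsol.cont_w hsol.cont_v).sub continuousOn_const
  · refine ContinuousOn.neg ?_
    have hi : IntegrableOn (fun s => ‖g s‖ ^ 2) (Icc a b) := by
      rw [integrableOn_Icc_iff_integrableOn_Ioc]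
      exact hsol.trace.1.integrable_norm_pow (by norm_num)
    exact intervalIntegral.continuousOn_primitive_interval (by rwa [uIcc_of_le hab.le])
      |>.mono (by rw [uIcc_of_le hab.le])
  · rw [closure_Ico hab.ne]

/-! ### Energy on the intervals with delayed damping -/

/-- With `F` bounded into `H`, the difference quotients converge pointwise in `H` and are bounded by
the supremum of `‖v‖`. Dominated convergence then identifies the limit `z` as `(F s).adjoint (v s)`.
-/
theorem PosOp.energy_sub_energy_of_bounded (A : PosOp H) {F : ℝ → U →L[ℝ] H}
    {w : ℝ → A.V} {v : ℝ → H} {g : ℝ → U} {a b c : ℝ} (hac : a ≤ c) (hcb : c < b)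
    (hF : ContinuousOn F (Icc a b)) (hw : ContinuousOn w (Icc a b))
    (hv : ContinuousOn v (Icc a b)) (hg : ContinuousOn g (Icc a b))
    (hderiv : ∀ s ∈ Icc a b, HasDerivWithinAt (fun r => A.incl (w r)) (v s) (Icc a b) s)
    (heqn : ∀ φ : A.V, ∀ s ∈ Icc a b, ⟪v s, A.incl φ⟫ - ⟪v a, A.incl φ⟫ +
      ∫ r in a..s, (⟪w r, φ⟫ + ⟪g r, (F r).adjoint (A.incl φ)⟫) = 0) :
    A.energy (w c) (v c) - A.energy (w a) (v a) =
      -∫ s in a..c, ⟪g s, (F s).adjoint (v s)⟫ := by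
  have hFc : ContinuousOn (fun r => (F r).adjoint) (Icc a b) :=
    (ContinuousLinearMap.adjoint (𝕜 := ℝ) (E := U) (F := H)).continuous.comp_continuousOn hF
  have hzc : ContinuousOn (fun s => (F s).adjoint (v s)) (Icc a b) := hFc.clm_apply hv
  have hmem : ∀ {f : ℝ → U} {d : ℝ}, d ≤ b → ContinuousOn f (Icc a b) →
      MemLp f 2 (volume.restrict (Ioc a d)) := by
    intro f d hd hf
    have hsub : Ioc a d ⊆ Icc a b := Ioc_subset_Icc_self.trans (Icc_subset_Icc_right hd)
    obtain ⟨B, hB⟩ := isCompact_Icc.exists_bound_of_continuousOn hf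
    refine MemLp.of_bound ((hf.mono hsub).aestronglyMeasurable measurableSet_Ioc) B ?_
    exact (ae_restrict_iff' measurableSet_Ioc).2
      (Eventually.of_forall fun r hr => hB r (hsub hr))
  refine A.energy_sub_energy_of_lt (N := fun r => (F r).adjoint ∘L A.incl) hac hcb
    (continuousOn_adjoint_comp hF _) (hasGraphModulus_adjoint_comp isCompact_Icc hF _) hw hv
    hderiv (hmem le_rfl hg) (hmem hcb.le hzc) (tendsto_eLpNorm_two_of_tendsto_lintegral ?_) heqn
  obtain ⟨B, hB⟩ := isCompact_Icc.exists_bound_of_continuousOn hF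
  obtain ⟨M, hM⟩ := isCompact_Icc.exists_bound_of_continuousOn hv
  have hquot : ∀ h s : ℝ, A.incl (h⁻¹ • (w (s + h) - w s)) =
      h⁻¹ • (A.incl (w (s + h)) - A.incl (w s)) := fun h s => by simp only [map_smul, map_sub]
  have h0 : ∫⁻ _ in Ioc a c, (0 : ENNReal) = 0 := by simp
  rw [← h0]
  refine tendsto_lintegral_filter_of_dominated_convergence'
    (fun _ => ENNReal.ofReal (B * M + B * M) ^ 2) ?_ ?_ ?_ ?_
  · filter_upwards [Ioo_mem_nhdsGT (sub_pos.2 hcb)] with h hh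
    have hsub : Ioc a c ⊆ Icc a c := Ioc_subset_Icc_self
    refine AEStronglyMeasurable.enorm ?_ |>.pow_const 2
    refine ContinuousOn.aestronglyMeasurable (ContinuousOn.mono ?_ hsub) measurableSet_Ioc
    exact ((continuousOn_adjoint_comp hF A.incl).mono (Icc_subset_Icc_right hcb.le)).clm_apply
      (continuousOn_diffQuot hw hh.1.le (by linarith [hh.2])) |>.sub
      (hzc.mono (Icc_subset_Icc_right hcb.le))
  · filter_upwards [Ioo_mem_nhdsGT (sub_pos.2 hcb)] with h hh
    refine (ae_restrict_iff' measurableSet_Ioc).2 (Eventually.of_forall fun s hs => ?_)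
    have hsb : s ∈ Icc a b := ⟨hs.1.le, hs.2.trans hcb.le⟩
    have hFn : ∀ x : H, ‖x‖ ≤ M → ‖(F s).adjoint x‖ ≤ B * M := fun x hx =>
      ((F s).adjoint.le_opNorm x).trans (by
        rw [LinearIsometryEquiv.norm_map]
        exact mul_le_mul (hB s hsb) hx (norm_nonneg _) ((norm_nonneg _).trans (hB s hsb)))
    gcongr
    rw [← ofReal_norm]
    refine ENNReal.ofReal_le_ofReal ((norm_sub_le _ _).trans (add_le_add ?_ (hFn _ (hM s hsb))))
    refine hFn _ ?_
    refine (congrArg norm (hquot h s)).trans_le ?_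
    exact norm_diffQuot_le hderiv hM hh.1 hsb.1 (by linarith [hh.2, hs.2])
  · rw [setLIntegral_const]
    simp [ENNReal.mul_eq_top]
  · refine (ae_restrict_iff' measurableSet_Ioc).2 (Eventually.of_forall fun s hs => ?_)
    have h1 := ((F s).adjoint.continuous.tendsto _).comp
      (tendsto_diffQuot hderiv ⟨hs.1.le, hs.2.trans_lt hcb⟩)
    have h2 := ((ENNReal.continuous_pow 2).tendsto _).comp
      (h1.sub_const ((F s).adjoint (v s))).enorm
    rw [sub_self, enorm_zero, zero_pow two_ne_zero] at h2
    refine h2.congr fun h => ?_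
    simp only [Function.comp_apply, ContinuousLinearMap.comp_apply, hquot]

/-- By Cauchy–Schwarz and `2xy ≤ x² + y²`, the energy derivative is at most `K * (‖p‖² + ‖v‖²) / 2`,
hence at most `K` times the energy plus `E₀`. -/
theorem PosOp.energy_add_le_of_delayed (A : PosOp H) {F : ℝ → U →L[ℝ] H}
    {w : ℝ → A.V} {v p : ℝ → H} {a b K E₀ : ℝ} (hF : ContinuousOn F (Icc a b))
    (hw : ContinuousOn w (Icc a b)) (hv : ContinuousOn v (Icc a b))
    (hp : ContinuousOn p (Icc a b))
    (hderiv : ∀ s ∈ Icc a b, HasDerivWithinAt (fun r => A.incl (w r)) (v s) (Icc a b) s)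
    (heqn : ∀ φ : A.V, ∀ s ∈ Icc a b, ⟪v s, A.incl φ⟫ - ⟪v a, A.incl φ⟫ +
      ∫ r in a..s, (⟪w r, φ⟫ + ⟪(F r).adjoint (p r), (F r).adjoint (A.incl φ)⟫) = 0)
    (hK : ∀ s ∈ Ico a b, ∀ x, ‖(F s).adjoint x‖ ^ 2 ≤ K * ‖x‖ ^ 2) (hK0 : 0 ≤ K)
    (hE₀ : ∀ s ∈ Ico a b, ‖p s‖ ^ 2 / 2 ≤ E₀) {s : ℝ} (hs : s ∈ Icc a b) :
    A.energy (w s) (v s) + E₀ ≤ (A.energy (w a) (v a) + E₀) * Real.exp (K * (s - a)) := by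
  have hFc : ContinuousOn (fun r => (F r).adjoint) (Icc a b) :=
    (ContinuousLinearMap.adjoint (𝕜 := ℝ) (E := U) (F := H)).continuous.comp_continuousOn hF
  have hgc : ContinuousOn (fun r => (F r).adjoint (p r)) (Icc a b) := hFc.clm_apply hp
  set q : ℝ → ℝ := fun r => ⟪(F r).adjoint (p r), (F r).adjoint (v r)⟫ with hq
  have hqc : ContinuousOn q (Icc a b) := hgc.inner (hFc.clm_apply hv)
  have hE : ∀ c ∈ Ico a b, A.energy (w c) (v c) = A.energy (w a) (v a) - ∫ r in a..c, q r := by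
    intro c hc
    linarith [A.energy_sub_energy_of_bounded hc.1 hc.2 hF hw hv hgc hderiv heqn]
  -- Adding the constant `E₀` to the unknown makes the differential inequality homogeneous.
  rw [← gronwallBound_ε0]
  refine le_gronwallBound_of_liminf_deriv_right_le (f' := fun r => -q r) (b := b)
    (f := fun r => A.energy (w r) (v r) + E₀)
    ((A.continuousOn_energy hw hv).add continuousOn_const) ?_ le_rfl ?_ s hs
  · intro c hc r hr
    have hcI : c ∈ Icc a b := Ico_subset_Icc_self hc
    have : Fact (c ∈ Icc a b) := ⟨hcI⟩
    have h1 : HasDerivWithinAt (fun c => ∫ r in a..c, q r) (q c) (Icc a b) c :=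
      intervalIntegral.integral_hasDerivWithinAt_right
        ((hqc.mono (Icc_subset_Icc_right hcI.2)).intervalIntegrable_of_Icc hc.1)
        (hqc.stronglyMeasurableAtFilter_nhdsWithin measurableSet_Icc c) (hqc c hcI)
    have h2 : HasDerivWithinAt (fun c => A.energy (w a) (v a) - (∫ r in a..c, q r) + E₀) (-q c)
        (Ici c) c := by
      refine ((h1.const_sub _).add_const _).mono_of_mem_nhdsWithin ?_
      exact mem_of_superset (Icc_mem_nhdsGE hc.2) (Icc_subset_Icc_left hc.1)
    have h3 : HasDerivWithinAt (fun c => A.energy (w c) (v c) + E₀) (-q c) (Ici c) c := by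
      refine h2.congr_of_eventuallyEq ?_ (by rw [hE c hc])
      filter_upwards [Ico_mem_nhdsGE hc.2] with r hr
      rw [hE r ⟨hc.1.trans hr.1, hr.2⟩]
    refine (h3.liminf_right_slope_le hr).mono fun z hz => ?_
    simpa [slope_def_module] using hz
  · intro r hr
    have h1 := hK r hr (p r)
    have h2 := hK r hr (v r)
    have h3 := hE₀ r hr
    have h4 : -q r ≤ (‖(F r).adjoint (p r)‖ ^ 2 + ‖(F r).adjoint (v r)‖ ^ 2) / 2 := by
      have h5 := real_inner_le_norm (-(F r).adjoint (p r)) ((F r).adjoint (v r))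
      rw [inner_neg_left, norm_neg] at h5
      have h6 : -q r ≤ ‖(F r).adjoint (p r)‖ * ‖(F r).adjoint (v r)‖ := h5
      linarith [two_mul_le_add_sq ‖(F r).adjoint (p r)‖ ‖(F r).adjoint (v r)‖]
    have h7 : ‖v r‖ ^ 2 / 2 ≤ A.energy (w r) (v r) := by
      unfold PosOp.energy
      linarith [sq_nonneg ‖w r‖]
    have h8 := mul_le_mul_of_nonneg_left (add_le_add h7 h3) hK0
    linarith

end Intervals

/-! ### Restriction of solutions of the delayed problem to the switching intervals -/

section Restriction

variable {H : Type*} [NormedAddCommGroup H] [InnerProductSpace ℝ H] [CompleteSpace H]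
  {U₁ : Type*} [NormedAddCommGroup U₁] [InnerProductSpace ℝ U₁] [CompleteSpace U₁]
  {U₂ : Type*} [NormedAddCommGroup U₂] [InnerProductSpace ℝ U₂] [CompleteSpace U₂]

theorem RegularB₁.exists_continuousOn {A : PosOp H} {B₁ : ℝ → U₁ →L[ℝ] StrongDual ℝ A.V}
    {a b : ℝ} (h : RegularB₁ A B₁ a b) :
    ∃ N : ℝ → A.V →L[ℝ] U₁, ContinuousOn N (Icc a b) ∧ ∀ r ∈ Ico a b, dualOp (B₁ r) = N r := by
  rcases h with ⟨F, hF, hB⟩ | ⟨β, L, ⟨β', K, hβ, -⟩, hpos, hB⟩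
  · refine ⟨_, continuousOn_adjoint_comp hF.continuousOn A.incl, fun r hr => ?_⟩
    rw [hB r hr, dualOp_pivot_comp]
  · refine ⟨_, (ContinuousOn.sqrt fun s hs => (hβ s hs).continuousWithinAt).smul
      (continuousOn_const (c := dualOp L)), fun r hr => ?_⟩
    rw [hB r hr, dualOp_smul]
    rfl

theorem RegularB₁.intervalIntegrable {A : PosOp H} {B₁ : ℝ → U₁ →L[ℝ] StrongDual ℝ A.V}
    {a b : ℝ} (hab : a ≤ b) (h : RegularB₁ A B₁ a b) {g : ℝ → U₁}
    (hg : MemLp g 2 (volume.restrict (Ioc a b))) (φ : A.V) :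
    IntervalIntegrable (fun r => ⟪g r, dualOp (B₁ r) φ⟫) volume a b := by
  obtain ⟨N, hN, hBN⟩ := h.exists_continuousOn
  have h1 := (integrableOn_inner_clm hN hg φ).mono_set Ioo_subset_Ioc_self
  rw [intervalIntegrable_iff_integrableOn_Ioo_of_le hab]
  refine h1.congr_fun (fun r hr => ?_) measurableSet_Ioo
  simp only [hBN r (Ioo_subset_Ico_self hr)]

variable {A : PosOp H} {B₁ : ℝ → U₁ →L[ℝ] StrongDual ℝ A.V} {B₂ : ℝ → U₂ →L[ℝ] H}
  {τ : ℝ} {t : ℕ → ℝ} {u : ℝ → A.V} {v : ℝ → H}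

/-- Integrability on every block permits splitting the integral at `t n`; a nonintegrable integrand
would give the default value zero. -/
theorem integral_eq_zero_of_switching {f X : ℝ → ℝ} (ht0 : t 0 = 0) (ht : StrictMono t)
    (hf : ∀ n, IntervalIntegrable f volume (t n) (t (n + 1)))
    (hX : ∀ s ∈ Ici (0 : ℝ), X s - X 0 + ∫ r in 0..s, f r = 0) (n : ℕ) {s : ℝ}
    (hs : s ∈ Icc (t n) (t (n + 1))) : X s - X (t n) + ∫ r in (t n)..s, f r = 0 := by
  have h1 : IntervalIntegrable f volume 0 (t n) := by
    have := IntervalIntegrable.trans_iterate (a := t) (n := n) fun k _ => hf k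
    rwa [ht0] at this
  have h2 : IntervalIntegrable f volume (t n) s := by
    refine (hf n).mono_set ?_
    rw [uIcc_of_le hs.1, uIcc_of_le (ht n.lt_succ_self).le]
    exact Icc_subset_Icc_right hs.2
  have h0 : 0 ≤ t n := ht0 ▸ ht.monotone n.zero_le
  have h3 := intervalIntegral.integral_add_adjacent_intervals h1 h2
  have h4 := hX _ (h0 : t n ∈ Ici 0)
  have h5 := hX s (h0.trans hs.1)
  linarith

theorem IsSol.restrict (hsol : IsSol A B₁ B₂ τ t u v) (ht0 : t 0 = 0) (ht : StrictMono t)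
    (hτ : τ ≤ t 1)
    (hB₂ : ∀ n, ∀ s ∈ Ico (t (2 * n)) (t (2 * n + 1)), B₂ s = 0)
    (hB₁ : ∀ n, ∀ s ∈ Ico (t (2 * n + 1)) (t (2 * n + 2)), B₁ s = 0)
    (hB₁reg : ∀ n, RegularB₁ A B₁ (t (2 * n)) (t (2 * n + 1)))
    (hB₂reg : ∀ n, RegularB₂ B₂ (t (2 * n + 1)) (t (2 * n + 2))) :
    (∃ g : ℝ → U₁, ∀ n, IsDampedSol A B₁ (t (2 * n)) (t (2 * n + 1)) u v g) ∧
    ∀ n, ∀ F : ℝ → U₂ →L[ℝ] H, (∀ s ∈ Ico (t (2 * n + 1)) (t (2 * n + 2)), B₂ s = F s) →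
      ∀ φ : A.V, ∀ s ∈ Icc (t (2 * n + 1)) (t (2 * n + 2)),
        ⟪v s, A.incl φ⟫ - ⟪v (t (2 * n + 1)), A.incl φ⟫ + ∫ r in (t (2 * n + 1))..s,
          (⟪u r, φ⟫ + ⟪(F r).adjoint (v (r - τ)), (F r).adjoint (A.incl φ)⟫) = 0 := by
  obtain ⟨g, htr, heqn⟩ := hsol.eqn
  have hlt : ∀ n, t n < t (n + 1) := fun n => ht n.lt_succ_self
  have hnn : ∀ n, 0 ≤ t n := fun n => ht0 ▸ ht.monotone n.zero_le
  have hsub : ∀ n, Icc (t n) (t (n + 1)) ⊆ Ici 0 := fun n s hs => (hnn n).trans hs.1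
  -- Open intervals suffice, and the right endpoint must be excluded: there the operators already
  -- belong to the next interval.
  have heven : ∀ n φ, EqOn (fun r => ⟪u r, φ⟫ + ⟪g r, dualOp (B₁ r) φ⟫ +
      ⟪(B₂ r).adjoint (v (r - τ)), (B₂ r).adjoint (A.incl φ)⟫)
      (fun r => ⟪u r, φ⟫ + ⟪g r, dualOp (B₁ r) φ⟫) (Ioo (t (2 * n)) (t (2 * n + 1))) := by
    intro n φ r hr
    simp [hB₂ n r (Ioo_subset_Ico_self hr)]
  have hodd : ∀ n φ, ∀ F : ℝ → U₂ →L[ℝ] H,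
      (∀ s ∈ Ico (t (2 * n + 1)) (t (2 * n + 2)), B₂ s = F s) →
      EqOn (fun r => ⟪u r, φ⟫ + ⟪g r, dualOp (B₁ r) φ⟫ +
        ⟪(B₂ r).adjoint (v (r - τ)), (B₂ r).adjoint (A.incl φ)⟫)
      (fun r => ⟪u r, φ⟫ + ⟪(F r).adjoint (v (r - τ)), (F r).adjoint (A.incl φ)⟫)
      (Ioo (t (2 * n + 1)) (t (2 * n + 2))) := by
    intro n φ F hF r hr
    simp [hB₁ n r (Ioo_subset_Ico_self hr), hF r (Ioo_subset_Ico_self hr), dualOp_zero]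
  have hui : ∀ n φ, IntervalIntegrable (fun r => ⟪u r, φ⟫) volume (t n) (t (n + 1)) :=
    fun n φ => ((hsol.cont_u.mono (hsub n)).inner continuousOn_const).intervalIntegrable_of_Icc
      (hlt n).le
  have hint : ∀ φ n, IntervalIntegrable (fun r => ⟪u r, φ⟫ + ⟪g r, dualOp (B₁ r) φ⟫ +
      ⟪(B₂ r).adjoint (v (r - τ)), (B₂ r).adjoint (A.incl φ)⟫) volume (t n) (t (n + 1)) := by
    intro φ n
    obtain ⟨m, rfl | rfl⟩ := n.even_or_odd'
    · have h1 := (hui (2 * m) φ).add ((hB₁reg m).intervalIntegrable (hlt _).le (htr m).1 φ)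
      rw [intervalIntegrable_iff_integrableOn_Ioo_of_le (hlt _).le] at h1 ⊢
      exact h1.congr_fun (heven m φ).symm measurableSet_Ioo
    · obtain ⟨F, hF, hBF⟩ := hB₂reg m
      have hFc : ContinuousOn (fun r => (F r).adjoint) (Icc (t (2 * m + 1)) (t (2 * m + 2))) :=
        (ContinuousLinearMap.adjoint (𝕜 := ℝ) (E := U₂) (F := H)).continuous.comp_continuousOn hF
      -- Since `τ ≤ t 1`, the delayed times are nonnegative, where `v` is known to be continuous.
      have hvτ : ContinuousOn (fun r => v (r - τ)) (Icc (t (2 * m + 1)) (t (2 * m + 2))) := by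
        refine hsol.cont_v.comp (by fun_prop) fun r hr => ?_
        have h2 : t 1 ≤ t (2 * m + 1) := ht.monotone (by omega)
        exact sub_nonneg.2 (hτ.trans (h2.trans hr.1))
      have h1 := (hui (2 * m + 1) φ).add (((hFc.clm_apply hvτ).inner
        (hFc.clm_apply (continuousOn_const (c := A.incl φ)))).intervalIntegrable_of_Icc (hlt (2 * m + 1)).le)
      rw [intervalIntegrable_iff_integrableOn_Ioo_of_le (hlt _).le] at h1 ⊢
      exact h1.congr_fun (hodd m φ F hBF).symm measurableSet_Ioo
  have hmain : ∀ φ n, ∀ s ∈ Icc (t n) (t (n + 1)), _ := fun φ n s hs =>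
    integral_eq_zero_of_switching (X := fun s => ⟪v s, A.incl φ⟫) ht0 ht (hint φ) (heqn φ) n hs
  have hcongr : ∀ {f₁ f₂ : ℝ → ℝ} {a b s : ℝ}, EqOn f₁ f₂ (Ioo a b) → s ∈ Icc a b →
      ∫ r in a..s, f₁ r = ∫ r in a..s, f₂ r := by
    intro f₁ f₂ a b s h hs
    rw [intervalIntegral.integral_of_le hs.1, intervalIntegral.integral_of_le hs.1,
      integral_Ioc_eq_integral_Ioo, integral_Ioc_eq_integral_Ioo]
    exact setIntegral_congr_fun measurableSet_Ioo fun r hr => h ⟨hr.1, hr.2.trans_le hs.2⟩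
  refine ⟨⟨g, fun n => ⟨hsol.cont_u.mono (hsub _), hsol.cont_v.mono (hsub _),
    fun s hs => (hsol.deriv s (hsub _ hs)).mono (hsub _), htr n, fun φ s hs => ?_⟩⟩,
    fun n F hF φ s hs => ?_⟩
  · rw [← hcongr (heven n φ) hs]
    exact hmain φ (2 * n) s hs
  · rw [← hcongr (hodd n φ F hF) hs]
    exact hmain φ (2 * n + 1) s hs

end Restriction

/-! ### Exponential decay -/

/-- With `n = ⌊s / P⌋₊` one has `q ^ n ≤ q ^ (s / P - 1)`; the lost period is the factor `q⁻¹`. -/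
theorem exp_decay_of_contraction {e : ℝ → ℝ} {q P : ℝ} (hq0 : 0 < q) (hq1 : q < 1) (hP : 0 < P)
    (he : ∀ n : ℕ, ∀ s ∈ Icc (n * P) ((n + 1) * P), e s ≤ e (n * P))
    (hc : ∀ n : ℕ, e ((n + 1) * P) ≤ q * e (n * P)) (h0 : 0 ≤ e 0) {s : ℝ} (hs : 0 ≤ s) :
    e s ≤ q⁻¹ * Real.exp (-(-Real.log q / P) * s) * e 0 := by
  have hn : ∀ n : ℕ, e (n * P) ≤ q ^ n * e 0 := by
    intro n
    induction n with
    | zero => simp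
    | succ n ih =>
      push_cast
      calc e ((n + 1) * P) ≤ q * e (n * P) := hc n
        _ ≤ q * (q ^ n * e 0) := by gcongr
        _ = _ := by ring
  have h1 := Nat.floor_le (div_nonneg hs hP.le)
  have h2 := (Nat.lt_floor_add_one (s / P)).le
  have h3 := he ⌊s / P⌋₊ s ⟨(le_div_iff₀ hP).1 h1, (div_le_iff₀ hP).1 h2⟩
  refine (h3.trans (hn _)).trans ?_
  gcongr
  have h4 : q ^ ⌊s / P⌋₊ = Real.exp (⌊s / P⌋₊ * Real.log q) := by
    rw [Real.exp_nat_mul, Real.exp_log hq0]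
  have h5 : q⁻¹ = Real.exp (-Real.log q) := by rw [Real.exp_neg, Real.exp_log hq0]
  rw [h4, h5, ← Real.exp_add]
  gcongr
  have h6 := Real.log_neg hq0 hq1
  have h7 : -(-Real.log q / P) * s = s / P * Real.log q := by ring
  rw [h7]
  nlinarith

end DelayDamping

/-! ### The decay theorem -/

theorem theorem4p4
    {H : Type*} [NormedAddCommGroup H] [InnerProductSpace ℝ H] [CompleteSpace H]
    {U₁ : Type*} [NormedAddCommGroup U₁] [InnerProductSpace ℝ U₁] [CompleteSpace U₁]
    {U₂ : Type*} [NormedAddCommGroup U₂] [InnerProductSpace ℝ U₂] [CompleteSpace U₂]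
    {W : Type*} [NormedAddCommGroup W] [InnerProductSpace ℝ W] [CompleteSpace W]
    -- the operator `A`, the damping operators, the delay, the switching times
    (A : PosOp H) (B₁ : ℝ → U₁ →L[ℝ] StrongDual ℝ A.V) (B₂ : ℝ → U₂ →L[ℝ] H)
    (τ : ℝ) (hτ : 0 < τ)
    (t : ℕ → ℝ) (ht0 : t 0 = 0) (ht : StrictMono t)
    (hB₂ : ∀ n, ∀ s ∈ Ico (t (2 * n)) (t (2 * n + 1)), B₂ s = 0)
    (hB₁ : ∀ n, ∀ s ∈ Ico (t (2 * n + 1)) (t (2 * n + 2)), B₁ s = 0)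
    (hB₁reg : ∀ n, RegularB₁ A B₁ (t (2 * n)) (t (2 * n + 1)))
    (hB₂reg : ∀ n, RegularB₂ B₂ (t (2 * n + 1)) (t (2 * n + 2)))
    -- the continuous embeddings `H → W` and `V → U₁`, and the bounds on `B₁*`, `B₂*`
    (k : H →L[ℝ] W) (C : ℝ) (hC : 0 < C) (hk : ∀ x, ‖k x‖ ^ 2 ≤ C * ‖x‖ ^ 2)
    (j : A.V →L[ℝ] U₁) (m M : ℕ → ℝ)
    (hm : ∀ n, 0 < m (2 * n)) (hmM : ∀ n, m (2 * n) ≤ M (2 * n))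
    (hM : ∀ n, 0 < M (2 * n + 1))
    (h_i : ∀ n, ∀ s ∈ Ico (t (2 * n)) (t (2 * n + 1)), ∀ x : A.V,
      m (2 * n) * ‖j x‖ ^ 2 ≤ ‖dualOp (B₁ s) x‖ ^ 2 ∧
        ‖dualOp (B₁ s) x‖ ^ 2 ≤ M (2 * n) * ‖j x‖ ^ 2)
    (h_ii : ∀ n, ∀ s ∈ Ico (t (2 * n + 1)) (t (2 * n + 2)), ∀ x : H,
      ‖(B₂ s).adjoint x‖ ^ 2 ≤ M (2 * n + 1) * ‖k x‖ ^ 2)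
    -- the lengths of the intervals
    (Tstar Ttilde : ℝ) (hTs : ∀ n, t (2 * n + 1) - t (2 * n) = Tstar)
    (hTt : ∀ n, t (2 * n + 2) - t (2 * n + 1) = Ttilde)
    (hTsτ : τ ≤ Tstar) (hTtτ : Ttilde ≤ τ)
    -- the observability inequality for the damped system
    (Tbar : ℕ → ℝ) (hTbar : ∀ n, 0 ≤ Tbar n ∧ Tbar n < Tstar)
    (d : ℕ → ℝ → ℝ) (hd : ∀ n, ∀ T ∈ Ioc (Tbar n) Tstar, 0 ≤ d n T)
    (hobs : ∀ n, ∀ T ∈ Ioc (Tbar n) Tstar,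
      Observable A B₁ (t (2 * n)) (t (2 * n + 1)) T (d n T))
    -- the smallness condition, with `d n Tstar / (d n Tstar + 1)` as contraction constant on `[t (2n), t (2n+1)]`
    (hbdd : BddAbove (range fun n =>
      Real.exp (C * M (2 * n + 1) * Ttilde) * (d n Tstar / (d n Tstar + 1) + 1) - 1))
    (hsup : ⨆ n, (Real.exp (C * M (2 * n + 1) * Ttilde) *
      (d n Tstar / (d n Tstar + 1) + 1) - 1) < 1) :
    ∃ γ > 0, ∃ μ > 0, ∀ (u : ℝ → A.V) (v : ℝ → H), IsSol A B₁ B₂ τ t u v →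
      ∀ s > 0, A.energy (u s) (v s) ≤ γ * Real.exp (-μ * s) * A.energy (u 0) (v 0) := by

  set q : ℝ := ⨆ n, (Real.exp (C * M (2 * n + 1) * Ttilde) *
    (d n Tstar / (d n Tstar + 1) + 1) - 1) with hq
  have hlt : ∀ n, t n < t (n + 1) := fun n => ht n.lt_succ_self
  have hTt0 : 0 < Ttilde := hTt 0 ▸ sub_pos.2 (hlt _)
  have hTs0 : 0 < Tstar := hτ.trans_le hTsτ
  -- Boundedness is essential: the real supremum of an unbounded family is zero by default.
  have hqn : ∀ n, Real.exp (C * M (2 * n + 1) * Ttilde) *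
      (d n Tstar / (d n Tstar + 1) + 1) - 1 ≤ q := fun n => le_ciSup hbdd n
  have hdn : ∀ n, 0 ≤ d n Tstar := fun n => hd n _ ⟨(hTbar n).2, le_rfl⟩
  have hq0 : 0 < q := by
    refine lt_of_lt_of_le ?_ (hqn 0)
    have h1 : 1 < Real.exp (C * M (2 * 0 + 1) * Ttilde) :=
      Real.one_lt_exp_iff.2 (mul_pos (mul_pos hC (hM 0)) hTt0)
    have h2 : 0 ≤ d 0 Tstar / (d 0 Tstar + 1) := div_nonneg (hdn 0) (by linarith [hdn 0])
    nlinarith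
  have hP : 0 < Tstar + Ttilde := add_pos hTs0 hTt0
  have htn : ∀ n : ℕ, t (2 * n) = n * (Tstar + Ttilde) := by
    intro n
    induction n with
    | zero => simp [ht0]
    | succ n ih =>
      have h1 := hTs n
      have h2 := hTt n
      rw [mul_add, mul_one]
      push_cast
      linarith
  refine ⟨q⁻¹, inv_pos.2 hq0, -Real.log q / (Tstar + Ttilde),
    div_pos (neg_pos.2 (Real.log_neg hq0 hsup)) hP, fun u v hsol s hs => ?_⟩
  have ht1 : t 1 = Tstar := by have := hTs 0; simp only [mul_zero, zero_add, ht0] at this; linarith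
  obtain ⟨⟨g, hdamp⟩, hdelay⟩ := hsol.restrict ht0 ht (hTsτ.trans ht1.ge) hB₂ hB₁ hB₁reg hB₂reg
  have hanti : ∀ n, ∀ s ∈ Icc (t (2 * n)) (t (2 * n + 1)),
      A.energy (u s) (v s) ≤ A.energy (u (t (2 * n))) (v (t (2 * n))) := by
    intro n s hs
    have h1 := (hdamp n).energy_sub_energy (hB₁reg n) (hlt _) hs
    have h2 : 0 ≤ ∫ r in (t (2 * n))..s, ‖g r‖ ^ 2 :=
      intervalIntegral.integral_nonneg hs.1 fun r _ => by positivity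
    linarith
  have hcontr : ∀ n, A.energy (u (t (2 * n + 1))) (v (t (2 * n + 1))) ≤
      d n Tstar / (d n Tstar + 1) * A.energy (u (t (2 * n))) (v (t (2 * n))) := by
    intro n
    have h1 := (hdamp n).energy_sub_energy (hB₁reg n) (hlt _) (right_mem_Icc.2 (hlt _).le)
    have h2 := hobs n Tstar ⟨(hTbar n).2, le_rfl⟩ u v g (hdamp n)
    have h3 : t (2 * n) + Tstar = t (2 * n + 1) := by linarith [hTs n]
    rw [h3] at h2
    have h4 := hdn n
    -- The goal becomes `E(b) * (d + 1) ≤ d * E(a)`, which is observability with the dissipation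
    -- replaced by the energy drop.
    rw [div_mul_eq_mul_div, le_div_iff₀ (by linarith)]
    have h5 : ∫ r in (t (2 * n))..(t (2 * n + 1)), ‖g r‖ ^ 2 =
      A.energy (u (t (2 * n))) (v (t (2 * n))) -
        A.energy (u (t (2 * n + 1))) (v (t (2 * n + 1))) := by linarith
    rw [h5] at h2
    linarith
  have hstep : ∀ n, ∀ s ∈ Icc (t (2 * n + 1)) (t (2 * n + 2)),
      A.energy (u s) (v s) ≤ q * A.energy (u (t (2 * n))) (v (t (2 * n))) := by
    intro n s hs
    obtain ⟨F, hF, hBF⟩ := hB₂reg n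
    have h0 : 0 ≤ t (2 * n) := ht0 ▸ ht.monotone (Nat.zero_le _)
    have hsub : Icc (t (2 * n + 1)) (t (2 * n + 2)) ⊆ Ici 0 := fun r hr =>
      h0.trans ((hlt _).le.trans hr.1)
    -- The left bound uses `τ ≤ Tstar`, the right one `Ttilde ≤ τ`: the delay always looks back into
    -- the preceding undelayed interval.
    have hmem : ∀ r ∈ Icc (t (2 * n + 1)) (t (2 * n + 2)),
        r - τ ∈ Icc (t (2 * n)) (t (2 * n + 1)) := fun r hr =>
      ⟨by linarith [hr.1, hTs n], by linarith [hr.2, hTt n]⟩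
    have hK : 0 ≤ C * M (2 * n + 1) := (mul_pos hC (hM n)).le
    have h1 := A.energy_add_le_of_delayed (p := fun r => v (r - τ)) (K := C * M (2 * n + 1))
      (E₀ := A.energy (u (t (2 * n))) (v (t (2 * n)))) hF (hsol.cont_u.mono hsub)
      (hsol.cont_v.mono hsub)
      (hsol.cont_v.comp (by fun_prop) fun r hr => h0.trans (hmem r hr).1)
      (fun r hr => (hsol.deriv r (hsub hr)).mono hsub) (hdelay n F hBF)
      (fun r hr x => by
        rw [← hBF r hr]
        calc ‖(B₂ r).adjoint x‖ ^ 2 ≤ M (2 * n + 1) * ‖k x‖ ^ 2 := h_ii n r hr x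
          _ ≤ M (2 * n + 1) * (C * ‖x‖ ^ 2) := mul_le_mul_of_nonneg_left (hk x) (hM n).le
          _ = _ := by ring) hK
      (fun r hr => by
        refine le_trans ?_ (hanti n _ (hmem r (Ico_subset_Icc_self hr)))
        unfold PosOp.energy
        linarith [sq_nonneg ‖u (r - τ)‖]) hs
    have hE0 := A.energy_nonneg (u (t (2 * n))) (v (t (2 * n)))
    have h2 : Real.exp (C * M (2 * n + 1) * (s - t (2 * n + 1))) ≤
        Real.exp (C * M (2 * n + 1) * Ttilde) := by
      gcongr
      linarith [hs.2, hTt n]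
    have h3 : 0 ≤ A.energy (u (t (2 * n + 1))) (v (t (2 * n + 1))) +
        A.energy (u (t (2 * n))) (v (t (2 * n))) := add_nonneg (A.energy_nonneg _ _) hE0
    have h4 := mul_le_mul_of_nonneg_left h2 h3
    -- The `+ 1` in the contraction factor is the initial shift by `E₀`, and the `- 1` is its
    -- removal after Gronwall.
    have h5 := mul_le_mul_of_nonneg_right (hcontr n)
      (Real.exp_pos (C * M (2 * n + 1) * Ttilde)).le
    have h6 := mul_le_mul_of_nonneg_right (hqn n) hE0
    linarith
  have hdecay := exp_decay_of_contraction (e := fun s => A.energy (u s) (v s)) hq0 hsup hP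
    ?_ ?_ (A.energy_nonneg _ _) hs.le
  · exact hdecay
  · intro n s hs
    have h1 : ((n : ℝ) + 1) * (Tstar + Ttilde) = t (2 * n + 2) := by
      have := htn (n + 1)
      rw [mul_add, mul_one] at this
      rw [this]
      push_cast
      ring
    rw [h1, ← htn] at hs
    rw [← htn]
    rcases le_total s (t (2 * n + 1)) with h | h
    · exact hanti n s ⟨hs.1, h⟩
    · exact (hstep n s ⟨h, hs.2⟩).trans
        (mul_le_of_le_one_left (A.energy_nonneg _ _) hsup.le)
  · intro n
    have h1 : ((n : ℝ) + 1) * (Tstar + Ttilde) = t (2 * n + 2) := by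
      have := htn (n + 1)
      rw [mul_add, mul_one] at this
      rw [this]
      push_cast
      ring
    rw [h1, ← htn]
    exact hstep n _ (right_mem_Icc.2 (hlt _).le)
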